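/- Theorem. Let $a_1,a_2\in\mathbb R^2$ be linearly independent and $b_1,b_2\in\mathbb R^2$ with $a_i\cdot b_j=2\pi\delta_{ij}$; put $\Lambda=\mathbb Z a_1+\mathbb Z a_2$, $\Lambda^*=\mathbb Z b_1+\mathbb Z b_2$, $D^*=\{\kappa_1b_1+\kappa_2b_2:\kappa_1,\kappa_2\in[-\tfrac12,\tfrac12]\}$, and let $V$ be the area of $\{r_1a_1+r_2a_2: r_1,r_2\in[-\tfrac12,\tfrac12]\}$. Let $H$ be a (real-)analytic, $\Lambda^*$-periodic family of Hermitian $n\times n$ matrices on $\mathbb R^2$, and for each $k=(k_x,k_y)\in\mathbb R^2$ let $E(k)\in\mathbb R$ be a nondegenerate eigenvalue of $H(k)$. An *assignment* is an analytic, $\Lambda^*$-periodic map $v:\mathbb R^2\to\mathbb C^n$ with $\|v(k)\|=1$ and $H(k)v(k)=E(k)v(k)$ for all $k$. Its Berry connection is the vector field $A^v=(\mathrm i\,v^*\partial_{k_x}v,\ \mathrm i\,v^*\partial_{k_y}v)$, which is real. With the Fourier coefficients $v_{i,R}=\frac{V}{(2\pi)^2}\int_{D^*}e^{-\mathrm iR\cdot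 k}v_i(k)\,dk$, $R\in\Lambda$, its Wannier center and variance are $$\langle R\rangle=\sum_{R\in\Lambda}\sum_{i=1}^n|v_{i,R}|^2(-R),\qquad \langle\|R\|^2\rangle-\|\langle R\rangle\|^2,\quad\text{where}\quad \langle\|R\|^2\rangle=\sum_{R\in\Lambda}\sum_{i=1}^n|v_{i,R}|^2\|R\|^2 .$$ An assignment is *optimal* if its variance is at most that of every assignment. Suppose that there is an assignment $\tilde u$; let $A=(A_x,A_y)$ be its Berry connection and $P=\tilde u\tilde u^*$ the projector. Then: 1. For every assignment $v$ the series for both moments converge absolutely, and $v$ and $A^v$ satisfy $\partial_{k_j}v=(\partial_{k_j}(vv^*))v-\mathrm iA^v_jv$ for $j=x,y$. 2. There are analytic $\Lambda^*$-periodic functions $\psi,F:\mathbb R^2\to\mathbb R$ and a vector $(h_x,h_y)\in\mathbb R^2$ with $$A=-\Big(\frac{\partial\psi}{\partial k_x},\frac{\partial\psi}{\partial k_y}\Big)+\Big(\frac{\partial F}{\partial k_y},-\frac{\partial F}{\partial k_x}\Big)+(h_x,h_y),\qquad(*)$$ and then $\psi$ solves $$\frac{\partial^2\psi}{\partial k_x^2}+\frac{\partial^2\psi}{\partial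 k_y^2}=-\Big(\frac{\partial A_x}{\partial k_x}+\frac{\partial A_y}{\partial k_y}\Big).\qquad(**)$$ 3. Let $\psi$ be any $\Lambda^*$-periodic $C^2$ solution of $(**)$, and let $F$ and $(h_x,h_y)$ be taken from any decomposition of $A$ of the form $(*)$ with $\Lambda^*$-periodic $C^2$ potentials. Then $w=e^{-\mathrm i\psi}\tilde u$ is an optimal assignment, its Berry connection is divergence-free and equals $$\Big(\frac{\partial F}{\partial k_y},-\frac{\partial F}{\partial k_x}\Big)+(h_x,h_y),$$ its Wannier center is $\langle R\rangle=(h_x,h_y)$, and its variance is $$\frac{V}{(2\pi)^2}\int_{D^*}\Big[\Big\|\frac{\partial P}{\partial k_x}w\Big\|^2+\Big\|\frac{\partial P}{\partial k_y}w\Big\|^2+\Big(\frac{\partial F}{\partial k_x}\Big)^2+\Big(\frac{\partial F}{\partial k_y}\Big)^2\Big]dk .$$ 4. The optimal, divergence-free Berry connection is unique up to a lattice vector: every optimal assignment has a divergence-free Berry connection, and if $v_1,v_2$ are assignments whose Berry connections are divergence-free, then $A^{v_1}-A^{v_2}$ is a constant vector $d\in\Lambda$. -/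

import Mathlib

open MeasureTheory

noncomputable section

/-- The plane `ℝ²` with its Euclidean structure; coordinate `0` is `x`, coordinate `1` is `y`. -/
abbrev Plane : Type := EuclideanSpace ℝ (Fin 2)

/-- `ℂⁿ` with its standard Hermitian inner product (conjugate-linear in the first slot). -/
abbrev CVec (n : ℕ) : Type := EuclideanSpace ℂ (Fin n)

/-- The lattice `{m₁ c₁ + m₂ c₂ : m₁, m₂ ∈ ℤ}`. -/
def lattice (c : Fin 2 → Plane) : Set Plane :=
  Set.range fun m : ℤ × ℤ => (m.1 : ℝ) • c 0 + (m.2 : ℝ) • c 1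

/-- The primitive cell `{r₁ c₁ + r₂ c₂ : r₁, r₂ ∈ [-1/2, 1/2]}`. -/
def primitiveCell (c : Fin 2 → Plane) : Set Plane :=
  (fun r : ℝ × ℝ => r.1 • c 0 + r.2 • c 1) ''
    (Set.Icc (-(1 / 2)) (1 / 2) ×ˢ Set.Icc (-(1 / 2)) (1 / 2))

/-- `a` are primitive vectors of a lattice `Λ` and `b` are the reciprocal primitive vectors,
`aᵢ · bⱼ = 2π δᵢⱼ`. -/
structure IsReciprocalPair (a b : Fin 2 → Plane) : Prop where
  linearIndependent : LinearIndependent ℝ a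
  inner_eq : ∀ i j, inner ℝ (a i) (b j) = if i = j then 2 * Real.pi else 0

/-- Periodicity with respect to the lattice generated by `b`. -/
def IsLatticePeriodic {X : Type*} (b : Fin 2 → Plane) (f : Plane → X) : Prop :=
  ∀ k, ∀ G ∈ lattice b, f (k + G) = f k

/-- The mean `V / (2π)² ∫_{D*} f(k) dk`, where `V` is the area of the cell of `a` and `D*` is
the cell of the reciprocal vectors `b`. -/
def cellMean {X : Type*} [NormedAddCommGroup X] [NormedSpace ℝ X] (a b : Fin 2 → Plane)
    (f : Plane → X) : X :=
  (volume.real (primitiveCell a) / (2 * Real.pi) ^ 2) • ∫ k in primitiveCell b, f k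

/-- The partial derivative `∂f/∂k_x` (`j = 0`) or `∂f/∂k_y` (`j = 1`). -/
def pd {X : Type*} [NormedAddCommGroup X] [NormedSpace ℝ X] (j : Fin 2) (f : Plane → X)
    (k : Plane) : X :=
  fderiv ℝ f k (EuclideanSpace.single j 1)

/-- The gradient `(∂f/∂k_x, ∂f/∂k_y)`. -/
def gradient2 (f : Plane → ℝ) (k : Plane) : Plane := !₂[pd 0 f k, pd 1 f k]

/-- The rotated gradient `(∂f/∂k_y, -∂f/∂k_x)`. -/
def rotGradient (f : Plane → ℝ) (k : Plane) : Plane := !₂[pd 1 f k, -pd 0 f k]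

/-- The divergence `∂A_x/∂k_x + ∂A_y/∂k_y`. -/
def divergence (A : Plane → Plane) (k : Plane) : ℝ :=
  pd 0 (fun q => A q 0) k + pd 1 (fun q => A q 1) k

/-- `f` is a classical periodic solution of `∂²f/∂k_x² + ∂²f/∂k_y² = -g`. -/
structure IsPeriodicPoissonSolution (b : Fin 2 → Plane) (g f : Plane → ℝ) : Prop where
  contDiff : ContDiff ℝ 2 f
  periodic : IsLatticePeriodic b f
  poisson : ∀ k, pd 0 (pd 0 f) k + pd 1 (pd 1 f) k = -g k

/-- `A = -(∂ψ/∂k_x, ∂ψ/∂k_y) + (∂F/∂k_y, -∂F/∂k_x) + h`, with periodic potentials `ψ`, `F` and a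
constant vector `h`. -/
structure IsHodgeDecomposition (b : Fin 2 → Plane) (A : Plane → Plane) (ψ F : Plane → ℝ)
    (h : Plane) : Prop where
  contDiff_ψ : ContDiff ℝ 2 ψ
  contDiff_F : ContDiff ℝ 2 F
  periodic_ψ : IsLatticePeriodic b ψ
  periodic_F : IsLatticePeriodic b F
  decomposition : ∀ k, A k = -gradient2 ψ k + rotGradient F k + h

/-- `H` is an analytic periodic family of Hermitian matrices and `E k` is, for every `k`, a
nondegenerate eigenvalue of `H k`. -/
structure IsNondegenerateBand {n : ℕ} (b : Fin 2 → Plane)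
    (H : Plane → Matrix (Fin n) (Fin n) ℂ) (E : Plane → ℝ) : Prop where
  hermitian : ∀ k, (H k).IsHermitian
  analytic : ∀ i j, AnalyticOnNhd ℝ (fun k => H k i j) Set.univ
  periodic : IsLatticePeriodic b H
  nondegenerate : ∀ k, Module.finrank ℂ
    (Module.End.eigenspace (Matrix.toEuclideanLin (H k)) (E k : ℂ)) = 1

/-- `u` is an analytic periodic assignment of normalized eigenvectors of `H` for the band `E`. -/
structure IsAssignment {n : ℕ} (b : Fin 2 → Plane) (H : Plane → Matrix (Fin n) (Fin n) ℂ)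
    (E : Plane → ℝ) (u : Plane → CVec n) : Prop where
  analytic : AnalyticOnNhd ℝ u Set.univ
  periodic : IsLatticePeriodic b u
  norm_eq_one : ∀ k, ‖u k‖ = 1
  eigen : ∀ k, Matrix.toEuclideanLin (H k) (u k) = (E k : ℂ) • u k

/-- The projector `P(k) = u(k) u(k)*`. -/
def projector {n : ℕ} (u : Plane → CVec n) (k : Plane) : CVec n →L[ℂ] CVec n :=
  InnerProductSpace.rankOne ℂ (u k) (u k)

/-- The Berry connection `A = (i u* ∂u/∂k_x, i u* ∂u/∂k_y)`. For normalized `u` both components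
are real, so that taking real parts only changes their type. -/
def berryConnection {n : ℕ} (u : Plane → CVec n) (k : Plane) : Plane :=
  !₂[(Complex.I * inner ℂ (u k) (pd 0 u k)).re, (Complex.I * inner ℂ (u k) (pd 1 u k)).re]

/-- `u` solves the Pfaffian system `∂u/∂k_j = (∂P/∂k_j) u - i A_j u`, `j = x, y`. -/
def SolvesPfaffian {n : ℕ} (u : Plane → CVec n) (A : Plane → Plane) : Prop :=
  ∀ k j, pd j u k = pd j (projector u) k (u k) - (Complex.I * (A k j : ℂ)) • u k

/-- The gauge transform `e^{-iφ} u`. -/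
def gaugeTransform {n : ℕ} (φ : Plane → ℝ) (u : Plane → CVec n) (k : Plane) : CVec n :=
  Complex.exp (-Complex.I * (φ k : ℂ)) • u k

/-- The Fourier coefficient `u_{i,R}` of the component `u_i`. -/
def fourierCoefficient {n : ℕ} (a b : Fin 2 → Plane) (u : Plane → CVec n) (i : Fin n)
    (R : Plane) : ℂ :=
  cellMean a b fun k => Complex.exp (-Complex.I * (inner ℝ R k : ℂ)) * u k i

/-- The weight `∑ᵢ |u_{i,R}|²` of the Wannier function at `R`. -/
def wannierWeight {n : ℕ} (a b : Fin 2 → Plane) (u : Plane → CVec n) (R : Plane) : ℝ :=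
  ∑ i, ‖fourierCoefficient a b u i R‖ ^ 2

/-- Both series defining the moments of the Wannier function converge absolutely. -/
def HasMoments {n : ℕ} (a b : Fin 2 → Plane) (u : Plane → CVec n) : Prop :=
  (Summable fun R : lattice a => wannierWeight a b u R * ‖(R : Plane)‖) ∧
    Summable fun R : lattice a => wannierWeight a b u R * ‖(R : Plane)‖ ^ 2

/-- The Wannier center `⟨R⟩ = ∑_R ∑ᵢ |u_{i,R}|² (-R)`. -/
def wannierCenter {n : ℕ} (a b : Fin 2 → Plane) (u : Plane → CVec n) : Plane :=
  ∑' R : lattice a, wannierWeight a b u R • (-(R : Plane))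

/-- The second moment `⟨‖R‖²⟩ = ∑_R ∑ᵢ |u_{i,R}|² ‖R‖²`. -/
def wannierSecondMoment {n : ℕ} (a b : Fin 2 → Plane) (u : Plane → CVec n) : ℝ :=
  ∑' R : lattice a, wannierWeight a b u R * ‖(R : Plane)‖ ^ 2

/-- The Wannier variance `⟨‖R‖²⟩ - ‖⟨R⟩‖²`. -/
def wannierVariance {n : ℕ} (a b : Fin 2 → Plane) (u : Plane → CVec n) : ℝ :=
  wannierSecondMoment a b u - ‖wannierCenter a b u‖ ^ 2

/-- `w` has the least variance among all analytic periodic assignments for the band. -/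
def IsOptimalAssignment {n : ℕ} (a b : Fin 2 → Plane) (H : Plane → Matrix (Fin n) (Fin n) ℂ)
    (E : Plane → ℝ) (w : Plane → CVec n) : Prop :=
  IsAssignment b H E w ∧
    ∀ v, IsAssignment b H E v → wannierVariance a b w ≤ wannierVariance a b v

end

/-! Everything is reduced to the vector calculus of Berry connections on the torus.

Parseval's identity turns the moments into means over the cell. Differentiation multiplies the
coefficient at R by iR_j, so the center of v is the mean of A^v (`wannierCenter_apply`) and the
second moment is the mean of ‖∂_x v‖² + ‖∂_y v‖² (`wannierSecondMoment_eq`). The vector (∂_jP)v is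
the part of ∂_jv orthogonal to v, whence ‖∂_jv‖² = ‖(∂_jP)v‖² + (A^v_j)² (`norm_pd_sq`).

Nondegeneracy makes two assignments differ by a phase c of modulus one. Thus P and ‖(∂_jP)v‖ do not
depend on the choice, and the variance is a fixed term plus mean |A^v|² − |mean A^v|². Moreover ∂_jc
= −i(A^v_j − A^w_j)c (`pd_inner_eq`), and symmetry of second derivatives makes A^v − A^w curl-free
(`curl_sub_eq_zero`). So every A^v is the same rotated gradient of F plus a curl-free field B. The
two are L²-orthogonal, and the variance becomes a common constant plus the variance of B
(`wannierVariance_eq`). It is least exactly when B is constant. The gauge e^{-iψ} adds ∇ψ to the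
connection and so achieves this, by cancelling the gradient part.

If two connections are divergence-free, their difference is divergence-free, curl-free and periodic.
Its components are harmonic, hence constant, say d. Then e^{i d·k}c(k) is constant, and periodicity
of c gives e^{i d·b_i} = 1, which means d ∈ Λ.

The gauge must be analytic. Fourier coefficients of an analytic periodic function decay
exponentially (`exists_norm_scalarCoeff_mul_exp_le`), dividing them by −‖R‖² preserves the decay,
and series with such coefficients are analytic (`analyticOnNhd_waveSum`). This solves Poisson's
equation analytically (`exists_analytic_poisson`). Any C² periodic solution differs from this one by
a constant. -/

noncomputable section

/-! ### Cells, lattices and their linear coordinates -/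

/-- The parametrization `r ↦ r₀ c₀ + r₁ c₁` of the plane. -/
def cellMap (c : Fin 2 → Plane) : (Fin 2 → ℝ) →L[ℝ] Plane :=
  (ContinuousLinearMap.proj 0).smulRight (c 0) + (ContinuousLinearMap.proj 1).smulRight (c 1)

lemma cellMap_apply (c : Fin 2 → Plane) (r : Fin 2 → ℝ) :
    cellMap c r = r 0 • c 0 + r 1 • c 1 := rfl

/-- The determinant of the matrix with rows `c₀`, `c₁`. -/
def cellDet (c : Fin 2 → Plane) : ℝ := c 0 0 * c 1 1 - c 0 1 * c 1 0

lemma inner_plane (x y : Plane) : inner ℝ x y = x 0 * y 0 + x 1 * y 1 := by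
  simp [PiLp.inner_apply, Fin.sum_univ_two]; ring

lemma norm_sq_plane (x : Plane) : ‖x‖ ^ 2 = x 0 ^ 2 + x 1 ^ 2 := by
  simp [EuclideanSpace.norm_sq_eq, Fin.sum_univ_two]

/-- The endomorphism `x ↦ x₀ c₀ + x₁ c₁` of the plane. -/
def cellEnd (c : Fin 2 → Plane) : Plane →L[ℝ] Plane :=
  cellMap c ∘L (PiLp.continuousLinearEquiv 2 ℝ fun _ : Fin 2 => ℝ).toContinuousLinearMap

lemma cellEnd_apply (c : Fin 2 → Plane) (x : Plane) : cellEnd c x = x 0 • c 0 + x 1 • c 1 := rfl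

lemma det_cellEnd (c : Fin 2 → Plane) : (cellEnd c).det = cellDet c := by
  have : (cellEnd c).det = LinearMap.det (cellEnd c : Plane →ₗ[ℝ] Plane) := rfl
  rw [this, ← LinearMap.det_toMatrix (EuclideanSpace.basisFun (Fin 2) ℝ).toBasis,
    Matrix.det_fin_two]
  simp [LinearMap.toMatrix_apply, cellEnd_apply, cellDet]
  ring

lemma cellMap_injective {c : Fin 2 → Plane} (hc : cellDet c ≠ 0) :
    Function.Injective (cellMap c) := by
  rw [injective_iff_map_eq_zero]
  intro r hr
  have h0 : r 0 * c 0 0 + r 1 * c 1 0 = 0 := by simpa [cellMap_apply] using congrArg (· 0) hr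
  have h1 : r 0 * c 0 1 + r 1 * c 1 1 = 0 := by simpa [cellMap_apply] using congrArg (· 1) hr
  unfold cellDet at hc
  ext i
  fin_cases i
  · change r 0 = 0
    exact (mul_eq_zero_iff_right hc).1 (by linear_combination c 1 1 * h0 - c 1 0 * h1)
  · change r 1 = 0
    exact (mul_eq_zero_iff_right hc).1 (by linear_combination c 0 0 * h1 - c 0 1 * h0)

lemma cellMap_surjective {c : Fin 2 → Plane} (hc : cellDet c ≠ 0) :
    Function.Surjective (cellMap c) := by
  intro x
  -- Cramer's rule.
  refine ⟨![(x 0 * c 1 1 - x 1 * c 1 0) / cellDet c, (x 1 * c 0 0 - x 0 * c 0 1) / cellDet c], ?_⟩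
  ext i
  fin_cases i
  · simp [cellMap_apply]; field_simp; unfold cellDet; ring
  · simp [cellMap_apply]; field_simp; unfold cellDet; ring

lemma primitiveCell_eq_image (c : Fin 2 → Plane) :
    primitiveCell c = cellEnd c ''
      ((WithLp.ofLp : Plane → _) ⁻¹' Set.Icc (fun _ => -(1 / 2)) fun _ => 1 / 2) := by
  ext x
  constructor
  · rintro ⟨⟨r, s⟩, ⟨hr, hs⟩, rfl⟩
    refine ⟨!₂[r, s], ⟨?_, ?_⟩, by simp [cellEnd_apply]⟩
    · intro i; fin_cases i
      · exact hr.1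
      · exact hs.1
    · intro i; fin_cases i
      · exact hr.2
      · exact hs.2
  · rintro ⟨y, ⟨h1, h2⟩, rfl⟩
    exact ⟨(y 0, y 1), ⟨⟨h1 0, h2 0⟩, ⟨h1 1, h2 1⟩⟩, rfl⟩

/-- A linear change of variables with constant Jacobian. Identifying `Plane` with `Fin 2 → ℝ`
preserves volume, so no further factor appears. -/
lemma setIntegral_primitiveCell {X : Type*} [NormedAddCommGroup X] [NormedSpace ℝ X]
    {c : Fin 2 → Plane} (hc : cellDet c ≠ 0) (f : Plane → X) :
    ∫ k in primitiveCell c, f k =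
      |cellDet c| • ∫ r in Set.Icc (fun _ => -(1 / 2)) fun _ => 1 / 2, f (cellMap c r) := by
  have hinj : Function.Injective (cellEnd c) :=
    (cellMap_injective hc).comp (WithLp.ofLp_injective 2)
  have hmeas : MeasurableSet ((WithLp.ofLp : Plane → _) ⁻¹'
      Set.Icc (fun _ => -(1 / 2)) fun _ => (1 / 2 : ℝ)) :=
    measurableSet_Icc.preimage (PiLp.volume_preserving_ofLp (Fin 2)).measurable
  rw [primitiveCell_eq_image, integral_image_eq_integral_abs_det_fderiv_smul volume hmeas
    (fun x _ => (cellEnd c).hasFDerivAt.hasFDerivWithinAt) hinj.injOn, det_cellEnd,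
    integral_smul]
  congr 1
  exact (PiLp.volume_preserving_ofLp (Fin 2)).setIntegral_preimage_emb
    (MeasurableEquiv.toLp 2 (Fin 2 → ℝ)).symm.measurableEmbedding (fun r => f (cellMap c r)) _

lemma volume_primitiveCell {c : Fin 2 → Plane} (hc : cellDet c ≠ 0) :
    volume.real (primitiveCell c) = |cellDet c| := by
  have h := setIntegral_primitiveCell hc (fun _ => (1 : ℝ))
  rw [setIntegral_const, setIntegral_const] at h
  have h2 : volume.real (Set.Icc (fun _ : Fin 2 => (-(1 / 2) : ℝ)) fun _ => 1 / 2) = 1 := by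
    rw [Measure.real, Real.volume_Icc_pi]
    norm_num
  rw [h2] at h
  simpa using h

/-- The Gram matrix (a_i · b_j) = 2π·1 is the product of the matrix of a and the transposed matrix
of b; take determinants. -/
lemma IsReciprocalPair.cellDet_mul {a b : Fin 2 → Plane} (hab : IsReciprocalPair a b) :
    cellDet a * cellDet b = (2 * Real.pi) ^ 2 := by
  have h := hab.inner_eq
  have h00 := h 0 0
  have h01 := h 0 1
  have h10 := h 1 0
  have h11 := h 1 1
  simp only [inner_plane, if_true, Fin.zero_eq_one_iff, Fin.one_eq_zero_iff, OfNat.ofNat_ne_one,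
    if_false] at h00 h01 h10 h11
  have : cellDet a * cellDet b =
    (a 0 0 * b 0 0 + a 0 1 * b 0 1) * (a 1 0 * b 1 0 + a 1 1 * b 1 1) -
    (a 0 0 * b 1 0 + a 0 1 * b 1 1) * (a 1 0 * b 0 0 + a 1 1 * b 0 1) := by
    unfold cellDet; ring
  rw [this, h00, h11, h01, h10]
  ring

lemma IsReciprocalPair.cellDet_left {a b : Fin 2 → Plane} (hab : IsReciprocalPair a b) :
    cellDet a ≠ 0 := by
  intro h
  have := hab.cellDet_mul
  rw [h, zero_mul] at this
  exact (pow_pos Real.two_pi_pos 2).ne this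

lemma IsReciprocalPair.cellDet_right {a b : Fin 2 → Plane} (hab : IsReciprocalPair a b) :
    cellDet b ≠ 0 := by
  intro h
  have := hab.cellDet_mul
  rw [h, mul_zero] at this
  exact (pow_pos Real.two_pi_pos 2).ne this

/-- The mean over the cell is an integral over the unit square. -/
lemma IsReciprocalPair.cellMean_eq {X : Type*} [NormedAddCommGroup X] [NormedSpace ℝ X]
    {a b : Fin 2 → Plane} (hab : IsReciprocalPair a b) (f : Plane → X) :
    cellMean a b f = ∫ r in Set.Icc (fun _ => -(1 / 2)) fun _ => 1 / 2, f (cellMap b r) := by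
  -- The normalization V/(2π)² cancels the Jacobian because |det a||det b| = (2π)².
  rw [cellMean, setIntegral_primitiveCell hab.cellDet_right, volume_primitiveCell hab.cellDet_left,
    smul_smul, ← hab.cellDet_mul, div_mul_eq_mul_div, ← abs_mul, hab.cellDet_mul,
    abs_of_pos (pow_pos Real.two_pi_pos 2), div_self (pow_pos Real.two_pi_pos 2).ne', one_smul]

/-- The lattice vector with integer coordinates `m`. -/
def latticeVec (c : Fin 2 → Plane) (m : Fin 2 → ℤ) : Plane := cellMap c fun i => (m i : ℝ)

lemma latticeVec_apply (c : Fin 2 → Plane) (m : Fin 2 → ℤ) :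
    latticeVec c m = (m 0 : ℝ) • c 0 + (m 1 : ℝ) • c 1 := rfl

lemma latticeVec_mem (c : Fin 2 → Plane) (m : Fin 2 → ℤ) : latticeVec c m ∈ lattice c :=
  ⟨(m 0, m 1), rfl⟩

lemma mem_lattice_iff {c : Fin 2 → Plane} {R : Plane} :
    R ∈ lattice c ↔ ∃ m, latticeVec c m = R := by
  constructor
  · rintro ⟨m, rfl⟩
    exact ⟨![m.1, m.2], by simp [latticeVec_apply]⟩
  · rintro ⟨m, rfl⟩
    exact latticeVec_mem c m

/-- Lattice points are indexed by their integer coordinates. -/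
def latticeEquiv {c : Fin 2 → Plane} (hc : cellDet c ≠ 0) : (Fin 2 → ℤ) ≃ lattice c :=
  Equiv.ofBijective (fun m => ⟨latticeVec c m, latticeVec_mem c m⟩) <| by
    constructor
    · intro m m' h
      have h1 := cellMap_injective hc (congrArg Subtype.val h)
      ext i
      exact_mod_cast congrFun h1 i
    · rintro ⟨R, hR⟩
      obtain ⟨m, rfl⟩ := mem_lattice_iff.1 hR
      exact ⟨m, rfl⟩

lemma latticeEquiv_coe {c : Fin 2 → Plane} (hc : cellDet c ≠ 0) (m : Fin 2 → ℤ) :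
    (latticeEquiv hc m : Plane) = latticeVec c m := rfl

lemma IsReciprocalPair.inner_latticeVec_cellMap {a b : Fin 2 → Plane}
    (hab : IsReciprocalPair a b) (m : Fin 2 → ℤ) (r : Fin 2 → ℝ) :
    inner ℝ (latticeVec a m) (cellMap b r) = 2 * Real.pi * (m 0 * r 0 + m 1 * r 1) := by
  simp only [latticeVec_apply, cellMap_apply, inner_add_left, inner_add_right, inner_smul_left,
    inner_smul_right, hab.inner_eq]
  simp
  ring

/-! ### Transfer to the torus -/

section Torus

/-- The normalized Haar measure on the torus. -/
def torusMeasure : Measure (UnitAddTorus (Fin 2)) := Measure.pi fun _ => AddCircle.haarAddCircle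

instance : Measure.IsAddHaarMeasure torusMeasure :=
  inferInstanceAs (Measure.IsAddHaarMeasure (Measure.pi fun _ : Fin 2 => AddCircle.haarAddCircle))

instance : IsProbabilityMeasure torusMeasure :=
  inferInstanceAs (IsProbabilityMeasure (Measure.pi fun _ : Fin 2 => AddCircle.haarAddCircle))

/-- A function on the plane, periodic with respect to the lattice of `b`, seen on the torus. -/
def torusLift {X : Type*} (b : Fin 2 → Plane) (f : Plane → X) (t : UnitAddTorus (Fin 2)) : X :=
  f (cellMap b fun i => (AddCircle.equivIoc 1 (-(1 / 2)) (t i)).1)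

/-- The representative chosen by `equivIoc` differs from r by an integer vector, which `cellMap b`
sends to a lattice vector. -/
lemma torusLift_coe {X : Type*} {b : Fin 2 → Plane} {f : Plane → X} (hf : IsLatticePeriodic b f)
    (r : Fin 2 → ℝ) : torusLift b f (fun i => (r i : UnitAddCircle)) = f (cellMap b r) := by
  have h : ∀ i, ∃ n : ℤ,
      (AddCircle.equivIoc 1 (-(1 / 2)) (r i : UnitAddCircle)).1 = r i + n := by
    intro i
    have h1 : (((AddCircle.equivIoc 1 (-(1 / 2)) (r i : UnitAddCircle)).1 : ℝ) : UnitAddCircle)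
        = (r i : UnitAddCircle) := AddCircle.coe_equivIoc
    rw [← sub_eq_zero, ← AddCircle.coe_sub, AddCircle.coe_eq_zero_iff] at h1
    obtain ⟨n, hn⟩ := h1
    exact ⟨n, by rw [← sub_eq_iff_eq_add', ← hn]; simp⟩
  choose m hm using h
  have : (fun i => (AddCircle.equivIoc 1 (-(1 / 2)) (r i : UnitAddCircle)).1) =
      r + fun i => (m i : ℝ) := funext hm
  rw [torusLift, this, map_add]
  exact hf _ _ (latticeVec_mem b m)

lemma isOpenQuotientMap_torus :
    IsOpenQuotientMap fun (r : Fin 2 → ℝ) (i : Fin 2) => (r i : UnitAddCircle) :=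
  IsOpenQuotientMap.piMap (f := fun _ (x : ℝ) => (x : UnitAddCircle))
    fun _ => QuotientAddGroup.isOpenQuotientMap_mk

/-- The chosen representative jumps at the boundary of the cell, but periodicity hides the jump:
continuity is tested on the quotient map, where the lift pulls back to f itself. -/
lemma continuous_torusLift {X : Type*} [TopologicalSpace X] {b : Fin 2 → Plane} {f : Plane → X} (hf : IsLatticePeriodic b f)
    (hc : Continuous f) : Continuous (torusLift b f) := by
  rw [isOpenQuotientMap_torus.isQuotientMap.continuous_iff]
  have : torusLift b f ∘ (fun (r : Fin 2 → ℝ) (i : Fin 2) => (r i : UnitAddCircle)) =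
      fun r => f (cellMap b r) := funext fun r => torusLift_coe hf r
  rw [this]
  exact hc.comp (cellMap b).continuous

lemma IsReciprocalPair.cellMean_eq_integral_torus {X : Type*} [NormedAddCommGroup X]
    [NormedSpace ℝ X] {a b : Fin 2 → Plane}
    (hab : IsReciprocalPair a b) {f : Plane → X} (hf : IsLatticePeriodic b f) :
    cellMean a b f = ∫ t, torusLift b f t ∂torusMeasure := by
  rw [hab.cellMean_eq]
  have h := UnitAddTorus.integral_preimage (torusLift b f) (fun _ => -(1 / 2))
  refine Eq.trans ?_ h.symm
  simp only [torusLift_coe hf]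
  -- The closed box and the half-open fundamental domain differ by a null set.
  refine setIntegral_congr_set ?_
  have h2 := (Measure.univ_pi_Ioc_ae_eq_Icc (μ := fun _ : Fin 2 => (volume : Measure ℝ))
    (f := fun _ => -(1 / 2)) (g := fun _ => 1 / 2)).symm
  have h3 : {x : Fin 2 → ℝ | ∀ i, x i ∈ Set.Ioc (-(1 / 2) : ℝ) (-(1 / 2) + 1)} =
      Set.univ.pi fun _ => Set.Ioc (-(1 / 2)) (1 / 2) := by
    ext x
    norm_num [Set.mem_pi]
  rw [h3]
  exact h2

end Torus

/-! ### Periodic functions -/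

namespace IsLatticePeriodic

variable {b : Fin 2 → Plane}

lemma comp {X Y : Type*} {f : Plane → X} (hf : IsLatticePeriodic b f) (g : X → Y) :
    IsLatticePeriodic b fun k => g (f k) := fun k G hG => congrArg g (hf k G hG)

lemma comp₂ {X Y Z : Type*} {f : Plane → X} {g : Plane → Y} (hf : IsLatticePeriodic b f)
    (hg : IsLatticePeriodic b g) (φ : X → Y → Z) :
    IsLatticePeriodic b fun k => φ (f k) (g k) := fun k G hG => by
  simp only [hf k G hG, hg k G hG]

lemma fderiv {X : Type*} [NormedAddCommGroup X] [NormedSpace ℝ X] {f : Plane → X}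
    (hf : IsLatticePeriodic b f) : IsLatticePeriodic b (fderiv ℝ f) := fun k G hG => by
  rw [← fderiv_comp_add_right]
  congr 1
  exact funext fun q => hf q G hG

lemma pd {X : Type*} [NormedAddCommGroup X] [NormedSpace ℝ X] {f : Plane → X}
    (hf : IsLatticePeriodic b f) (j : Fin 2) : IsLatticePeriodic b (pd j f) :=
  hf.fderiv.comp fun L => L (EuclideanSpace.single j 1)

lemma exists_norm_le {X : Type*} [NormedAddCommGroup X] {f : Plane → X}
    (hf : IsLatticePeriodic b f) (hb : cellDet b ≠ 0) (hc : Continuous f) :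
    ∃ C, ∀ k, ‖f k‖ ≤ C := by
  obtain ⟨C, hC⟩ := (isCompact_range (continuous_torusLift hf hc)).isBounded.exists_norm_le
  refine ⟨C, fun k => ?_⟩
  obtain ⟨r, rfl⟩ := cellMap_surjective hb k
  rw [← torusLift_coe hf]
  exact hC _ ⟨_, rfl⟩

end IsLatticePeriodic

/-! ### The mean over the cell -/

section Mean

variable {X Y : Type*} [NormedAddCommGroup X] [NormedSpace ℝ X] [NormedAddCommGroup Y]
  [NormedSpace ℝ Y] {a b : Fin 2 → Plane}

lemma integrableOn_box {X : Type*} [NormedAddCommGroup X] {b : Fin 2 → Plane} {f : Plane → X} (hf : Continuous f) :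
    IntegrableOn (fun r => f (cellMap b r)) (Set.Icc (fun _ => -(1 / 2)) fun _ => 1 / 2) :=
  (hf.comp (cellMap b).continuous).integrableOn_Icc

namespace IsReciprocalPair

lemma cellMean_add (hab : IsReciprocalPair a b) {f g : Plane → X} (hf : Continuous f)
    (hg : Continuous g) :
    cellMean a b (fun k => f k + g k) = cellMean a b f + cellMean a b g := by
  simp only [hab.cellMean_eq]
  exact integral_add (integrableOn_box hf) (integrableOn_box hg)

lemma cellMean_sub (hab : IsReciprocalPair a b) {f g : Plane → X} (hf : Continuous f)
    (hg : Continuous g) :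
    cellMean a b (fun k => f k - g k) = cellMean a b f - cellMean a b g := by
  simp only [hab.cellMean_eq]
  exact integral_sub (integrableOn_box hf) (integrableOn_box hg)

lemma cellMean_sum (hab : IsReciprocalPair a b) {ι : Type*} [Fintype ι] {f : ι → Plane → X}
    (hf : ∀ i, Continuous (f i)) :
    cellMean a b (fun k => ∑ i, f i k) = ∑ i, cellMean a b (f i) := by
  simp only [hab.cellMean_eq]
  exact integral_finsetSum _ fun i _ => integrableOn_box (hf i)

lemma cellMean_const_mul (hab : IsReciprocalPair a b) {𝕜 : Type*} [RCLike 𝕜] (c : 𝕜)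
    (f : Plane → 𝕜) : cellMean a b (fun k => c * f k) = c * cellMean a b f := by
  simp only [hab.cellMean_eq]
  exact integral_const_mul c _

lemma cellMean_const [CompleteSpace X] (hab : IsReciprocalPair a b) (x : X) :
    cellMean a b (fun _ => x) = x := by
  rw [hab.cellMean_eq, setIntegral_const, Measure.real, Real.volume_Icc_pi]
  norm_num

lemma cellMean_clm [CompleteSpace X] [CompleteSpace Y] (hab : IsReciprocalPair a b) (L : X →L[ℝ] Y)
    {f : Plane → X} (hf : Continuous f) :
    cellMean a b (fun k => L (f k)) = L (cellMean a b f) := by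
  simp only [hab.cellMean_eq]
  exact L.integral_comp_comm (integrableOn_box hf)

lemma cellMean_nonneg (hab : IsReciprocalPair a b) {f : Plane → ℝ} (hf : ∀ k, 0 ≤ f k) :
    0 ≤ cellMean a b f := by
  rw [hab.cellMean_eq]
  exact integral_nonneg fun _ => hf _

lemma norm_cellMean_le (hab : IsReciprocalPair a b) {f : Plane → X} {C : ℝ}
    (hC : ∀ k, ‖f k‖ ≤ C) : ‖cellMean a b f‖ ≤ C := by
  rw [hab.cellMean_eq]
  have h := norm_setIntegral_le_of_norm_le_const
    (s := Set.Icc (fun _ : Fin 2 => (-(1 / 2) : ℝ)) fun _ => 1 / 2) (μ := volume)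
    (by rw [Real.volume_Icc_pi]; norm_num) (fun r _ => hC (cellMap b r))
  rw [Measure.real, Real.volume_Icc_pi] at h
  norm_num at h ⊢
  exact h

/-- Haar measure charges every nonempty open subset of the torus, so a continuous nonnegative
function that is positive somewhere has positive mean. -/
lemma eq_zero_of_cellMean_eq_zero (hab : IsReciprocalPair a b) {f : Plane → ℝ}
    (hf : IsLatticePeriodic b f) (hc : Continuous f) (h0 : ∀ k, 0 ≤ f k)
    (hM : cellMean a b f = 0) (k : Plane) : f k = 0 := by
  by_contra hk
  obtain ⟨r, rfl⟩ := cellMap_surjective hab.cellDet_right k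
  rw [← torusLift_coe hf] at hk
  have := (continuous_torusLift hf hc).integral_pos_of_hasCompactSupport_nonneg_nonzero
    (μ := torusMeasure) (HasCompactSupport.of_compactSpace _) (fun _ => h0 _) hk
  rw [← hab.cellMean_eq_integral_torus hf, hM] at this
  exact lt_irrefl _ this

/-- A translation of the plane induces a translation of the torus, which preserves Haar measure. -/
lemma cellMean_translate (hab : IsReciprocalPair a b) {f : Plane → X}
    (hf : IsLatticePeriodic b f) (v : Plane) :
    cellMean a b (fun k => f (k + v)) = cellMean a b f := by
  obtain ⟨s, rfl⟩ := cellMap_surjective hab.cellDet_right v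
  have hf' : IsLatticePeriodic b fun k => f (k + cellMap b s) := fun k G hG => by
    simp only [add_right_comm k G, hf _ G hG]
  rw [hab.cellMean_eq_integral_torus hf, hab.cellMean_eq_integral_torus hf',
    ← integral_add_right_eq_self (torusLift b f) (fun i => (s i : UnitAddCircle))]
  congr 1
  ext t
  obtain ⟨r, rfl⟩ := isOpenQuotientMap_torus.surjective t
  have h1 := torusLift_coe hf (r + s)
  rw [map_add] at h1
  refine (torusLift_coe hf' r).trans (h1.symm.trans ?_)
  congr 1

/-- The mean of f(k + tv) does not depend on t. Differentiating under the integral at t = 0, with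
the global bound of a continuous periodic function as majorant, gives the claim without any boundary
terms. -/
lemma cellMean_fderiv (hab : IsReciprocalPair a b) {f : Plane → X}
    (hf : IsLatticePeriodic b f) (hc : ContDiff ℝ 1 f) (v : Plane) :
    cellMean a b (fun k => fderiv ℝ f k v) = 0 := by
  have hc' : Continuous fun k => fderiv ℝ f k v :=
    (hc.continuous_fderiv one_ne_zero).clm_apply continuous_const
  obtain ⟨C, hC⟩ := (hf.fderiv.comp fun L => L v).exists_norm_le hab.cellDet_right hc'
  set μ := (volume : Measure (Fin 2 → ℝ)).restrict
    (Set.Icc (fun _ => -(1 / 2)) fun _ => 1 / 2) with hμ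
  have hf_cont : ∀ t : ℝ, Continuous fun r => f (cellMap b r + t • v) := fun t =>
    hc.continuous.comp ((cellMap b).continuous.add continuous_const)
  have key := (hasDerivAt_integral_of_dominated_loc_of_deriv_le (μ := μ)
    (F := fun t r => f (cellMap b r + t • v))
    (F' := fun t r => fderiv ℝ f (cellMap b r + t • v) v) (x₀ := (0 : ℝ)) (s := Set.univ)
    (bound := fun _ => C) Filter.univ_mem
    (Filter.Eventually.of_forall fun t => (hf_cont t).aestronglyMeasurable)
    ((hf_cont 0).integrableOn_Icc)
    ((hc'.comp ((cellMap b).continuous.add continuous_const)).aestronglyMeasurable)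
    (Filter.Eventually.of_forall fun r t _ => hC _)
    (integrableOn_box (f := fun _ => C) (b := b) continuous_const)
    (Filter.Eventually.of_forall fun r t _ => by
      have h1 := (hc.differentiable one_ne_zero (cellMap b r + t • v)).hasFDerivAt
      have h2 : HasDerivAt (fun t : ℝ => cellMap b r + t • v) v t := by
        simpa using ((hasDerivAt_id t).smul_const v).const_add (cellMap b r)
      exact h1.comp_hasDerivAt t h2)).2
  have hconst : (fun t : ℝ => ∫ r, f (cellMap b r + t • v) ∂μ) = fun _ => cellMean a b f := by
    ext t
    rw [← hab.cellMean_translate hf (t • v), hab.cellMean_eq]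
  rw [hconst] at key
  have := key.unique (hasDerivAt_const _ _)
  rw [hab.cellMean_eq]
  simpa only [zero_smul, add_zero] using this

lemma cellMean_pd (hab : IsReciprocalPair a b) {f : Plane → X}
    (hf : IsLatticePeriodic b f) (hc : ContDiff ℝ 1 f) (j : Fin 2) :
    cellMean a b (pd j f) = 0 := hab.cellMean_fderiv hf hc _

end IsReciprocalPair

end Mean

/-! ### Fourier coefficients and Parseval's identity -/

/-- The plane wave `k ↦ exp (i R · k)` for the lattice vector `R` with coordinates `m`. -/
def planeWave (a : Fin 2 → Plane) (m : Fin 2 → ℤ) (k : Plane) : ℂ :=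
  Complex.exp (Complex.I * (inner ℝ (latticeVec a m) k : ℂ))

/-- The Fourier coefficient of a scalar function at the lattice vector with coordinates `m`. -/
def scalarCoeff (a b : Fin 2 → Plane) (f : Plane → ℂ) (m : Fin 2 → ℤ) : ℂ :=
  cellMean a b fun k => Complex.exp (-Complex.I * (inner ℝ (latticeVec a m) k : ℂ)) * f k

namespace IsReciprocalPair

variable {a b : Fin 2 → Plane}

lemma mFourier_coe (hab : IsReciprocalPair a b) (m : Fin 2 → ℤ) (r : Fin 2 → ℝ) :
    UnitAddTorus.mFourier m (fun i => (r i : UnitAddCircle)) = planeWave a m (cellMap b r) := by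
  simp only [UnitAddTorus.mFourier, ContinuousMap.coe_mk, Fin.prod_univ_two, fourier_coe_apply,
    planeWave, hab.inner_latticeVec_cellMap, ← Complex.exp_add]
  congr 1
  push_cast
  ring

lemma planeWave_periodic (hab : IsReciprocalPair a b) (m : Fin 2 → ℤ) :
    IsLatticePeriodic b (planeWave a m) := fun k G hG => by
  obtain ⟨r, rfl⟩ := cellMap_surjective hab.cellDet_right k
  obtain ⟨p, rfl⟩ := mem_lattice_iff.1 hG
  have : cellMap b r + latticeVec b p = cellMap b (r + fun i => (p i : ℝ)) := (map_add _ _ _).symm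
  rw [this, ← hab.mFourier_coe, ← hab.mFourier_coe]
  congr 1
  ext i
  simp

lemma planeWave_neg (m : Fin 2 → ℤ) (k : Plane) : planeWave a (-m) k =
    Complex.exp (-Complex.I * (inner ℝ (latticeVec a m) k : ℂ)) := by
  have : latticeVec a (-m) = - latticeVec a m := by
    simp [latticeVec_apply]; abel
  rw [planeWave, this, inner_neg_left]
  push_cast
  ring_nf

/-- The bridge through which the Fourier theory of `UnitAddTorus` applies to periodic functions on
the plane. -/
lemma mFourierCoeff_torusLift (hab : IsReciprocalPair a b) {f : Plane → ℂ}
    (hf : IsLatticePeriodic b f) (m : Fin 2 → ℤ) :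
    UnitAddTorus.mFourierCoeff (torusLift b f) m = scalarCoeff a b f m := by
  simp only [scalarCoeff, ← planeWave_neg]
  rw [hab.cellMean_eq_integral_torus ((hab.planeWave_periodic (-m)).comp₂ hf (· * ·))]
  refine integral_congr_ae (Filter.Eventually.of_forall fun t => ?_)
  obtain ⟨r, rfl⟩ := isOpenQuotientMap_torus.surjective t
  refine Eq.trans ?_ (torusLift_coe ((hab.planeWave_periodic (-m)).comp₂ hf (· * ·)) r).symm
  change UnitAddTorus.mFourier (-m) (fun i => (r i : UnitAddCircle)) *
    torusLift b f (fun i => (r i : UnitAddCircle)) = _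
  rw [torusLift_coe hf, hab.mFourier_coe]

/-- Parseval's identity for continuous periodic functions. -/
lemma hasSum_conj_scalarCoeff_mul (hab : IsReciprocalPair a b) {f g : Plane → ℂ}
    (hf : IsLatticePeriodic b f) (hfc : Continuous f) (hg : IsLatticePeriodic b g)
    (hgc : Continuous g) :
    HasSum (fun m => starRingEnd ℂ (scalarCoeff a b f m) * scalarCoeff a b g m)
      (cellMean a b fun k => starRingEnd ℂ (f k) * g k) := by
  let F : C(UnitAddTorus (Fin 2), ℂ) := ⟨_, continuous_torusLift hf hfc⟩
  let G : C(UnitAddTorus (Fin 2), ℂ) := ⟨_, continuous_torusLift hg hgc⟩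
  have h := UnitAddTorus.hasSum_prod_mFourierCoeff (d := Fin 2)
    (ContinuousMap.toLp 2 torusMeasure ℂ F) (ContinuousMap.toLp 2 torusMeasure ℂ G)
  have hF : ∀ m, UnitAddTorus.mFourierCoeff (ContinuousMap.toLp 2 torusMeasure ℂ F) m =
      scalarCoeff a b f m := fun m =>
    (UnitAddTorus.mFourierCoeff_toLp F m).trans (hab.mFourierCoeff_torusLift hf m)
  have hG : ∀ m, UnitAddTorus.mFourierCoeff (ContinuousMap.toLp 2 torusMeasure ℂ G) m =
      scalarCoeff a b g m := fun m =>
    (UnitAddTorus.mFourierCoeff_toLp G m).trans (hab.mFourierCoeff_torusLift hg m)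
  refine (congrArg₂ HasSum (funext fun m =>
    congrArg₂ (fun x y => starRingEnd ℂ x * y) (hF m) (hG m)) ?_).mp h
  symm
  rw [hab.cellMean_eq_integral_torus (hf.comp₂ hg fun x y => starRingEnd ℂ x * y)]
  refine integral_congr_ae ?_
  filter_upwards [ContinuousMap.coeFn_toLp (𝕜 := ℂ) (p := 2) torusMeasure F,
    ContinuousMap.coeFn_toLp (𝕜 := ℂ) (p := 2) torusMeasure G] with t h1 h2
  exact (congrArg₂ (fun x y => starRingEnd ℂ x * y) h1 h2).symm

/-- A continuous periodic function with summable Fourier coefficients is its Fourier series. -/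
lemma hasSum_scalarCoeff_mul_planeWave (hab : IsReciprocalPair a b) {f : Plane → ℂ}
    (hf : IsLatticePeriodic b f) (hfc : Continuous f) (hs : Summable (scalarCoeff a b f))
    (k : Plane) : HasSum (fun m => scalarCoeff a b f m * planeWave a m k) (f k) := by
  obtain ⟨r, rfl⟩ := cellMap_surjective hab.cellDet_right k
  let F : C(UnitAddTorus (Fin 2), ℂ) := ⟨_, continuous_torusLift hf hfc⟩
  have hF : ∀ m, UnitAddTorus.mFourierCoeff F m = scalarCoeff a b f m :=
    hab.mFourierCoeff_torusLift hf
  have h := UnitAddTorus.hasSum_mFourier_series_apply_of_summable (f := F)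
    (by rwa [funext hF]) (fun i => (r i : UnitAddCircle))
  simp only [hF, hab.mFourier_coe, smul_eq_mul] at h
  rwa [← torusLift_coe hf]

end IsReciprocalPair

/-! ### Cauchy estimates and sums of power series -/

section PowerSeries

open Topology

variable {E F : Type*} [NormedAddCommGroup E] [NormedSpace ℝ E] [NormedAddCommGroup F]
  [NormedSpace ℝ F] [CompleteSpace F]

/-- Locally uniform Cauchy estimates for the directional derivatives of an analytic map. -/
lemma AnalyticAt.exists_norm_iteratedFDeriv_le {f : E → F} {x : E} (hf : AnalyticAt ℝ f x) (v : E) :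
    ∃ C M : ℝ, 0 ≤ C ∧ 0 ≤ M ∧ ∀ᶠ y in 𝓝 x, ∀ n : ℕ,
      ‖iteratedFDeriv ℝ n f y fun _ => v‖ ≤ C * n.factorial * M ^ n := by
  obtain ⟨p, ρ, hp⟩ := hf
  obtain ⟨s, hs0, hsρ⟩ := ENNReal.lt_iff_exists_nnreal_btwn.1 hp.r_pos
  have hs0' : 0 < s := by exact_mod_cast hs0
  -- Halving the radius leaves room to recentre at any point within r and still converge at radius
  -- r.
  set r : NNReal := s / 2 with hr
  have hr0 : 0 < r := by positivity
  have hrr : (r : ENNReal) + r = s := by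
    rw [← ENNReal.coe_add, hr, add_halves]
  have hS := p.changeOriginSeries_summable_aux₁ (r := r) (r' := r)
    (by rw [hrr]; exact hsρ.trans_le hp.r_le)
  have hfib : ∀ k, Summable fun q : Σ l : ℕ, { s : Finset (Fin (k + l)) // s.card = l } =>
      ‖p (k + q.1)‖₊ * r ^ q.1 * r ^ k := (NNReal.summable_sigma.1 hS).1
  have htot : Summable fun k => ∑' q : Σ l : ℕ, { s : Finset (Fin (k + l)) // s.card = l },
      ‖p (k + q.1)‖₊ * r ^ q.1 * r ^ k := (NNReal.summable_sigma.1 hS).2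
  -- One constant serves all degrees, since each term of a convergent nonnegative series is at most
  -- its sum.
  obtain ⟨T, hT⟩ : ∃ T : NNReal, ∀ k,
      ∑' q : Σ l : ℕ, { s : Finset (Fin (k + l)) // s.card = l },
        ‖p (k + q.1)‖₊ * r ^ q.1 * r ^ k ≤ T := ⟨_, fun k => htot.le_tsum' k⟩
  have hrρ : (r : ENNReal) < ρ := lt_of_le_of_lt (by rw [← hrr]; exact le_self_add) hsρ
  have hbound : ∀ z : E, ‖z‖₊ ≤ r → ∀ k, ‖p.changeOrigin z k‖₊ * r ^ k ≤ T := by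
    intro z hz k
    have hz' : (‖z‖₊ : ENNReal) ≤ r := by exact_mod_cast hz
    have hle : ∀ q : Σ l : ℕ, { s : Finset (Fin (k + l)) // s.card = l },
        ‖p (k + q.1)‖₊ * ‖z‖₊ ^ q.1 * r ^ k ≤ ‖p (k + q.1)‖₊ * r ^ q.1 * r ^ k := fun q => by
      gcongr
    calc ‖p.changeOrigin z k‖₊ * r ^ k
        ≤ (∑' q : Σ l : ℕ, { s : Finset (Fin (k + l)) // s.card = l },
            ‖p (k + q.1)‖₊ * ‖z‖₊ ^ q.1) * r ^ k := by
          gcongr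
          exact p.nnnorm_changeOrigin_le k ((hz'.trans_lt hrρ).trans_le hp.r_le)
      _ = ∑' q : Σ l : ℕ, { s : Finset (Fin (k + l)) // s.card = l },
            ‖p (k + q.1)‖₊ * ‖z‖₊ ^ q.1 * r ^ k := (NNReal.tsum_mul_right _ _).symm
      _ ≤ ∑' q : Σ l : ℕ, { s : Finset (Fin (k + l)) // s.card = l },
            ‖p (k + q.1)‖₊ * r ^ q.1 * r ^ k :=
          (NNReal.summable_of_le hle (hfib k)).tsum_le_tsum hle (hfib k)
      _ ≤ T := hT k
  refine ⟨T, ‖v‖ / r, T.2, by positivity, ?_⟩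
  filter_upwards [Metric.ball_mem_nhds x (show (0 : ℝ) < r by exact_mod_cast hr0)] with y hy n
  have hz : ‖y - x‖₊ ≤ r := by
    rw [mem_ball_iff_norm] at hy
    exact_mod_cast hy.le
  have hq := hp.changeOrigin (y := y - x)
    (lt_of_le_of_lt (by exact_mod_cast hz) hrρ)
  rw [add_sub_cancel] at hq
  -- The n-th derivative along v is n! times the n-th coefficient of the recentred series evaluated
  -- on v.
  rw [← hq.factorial_smul v n, ← Nat.cast_smul_eq_nsmul ℝ, norm_smul, Real.norm_natCast]
  have h1 : ‖p.changeOrigin (y - x) n fun _ => v‖ ≤ ‖p.changeOrigin (y - x) n‖ * ‖v‖ ^ n := by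
    simpa using (p.changeOrigin (y - x) n).le_opNorm fun _ => v
  have h2 : ‖p.changeOrigin (y - x) n‖ * (r : ℝ) ^ n ≤ T := by
    exact_mod_cast hbound _ hz n
  have hr0' : (0 : ℝ) < r := by exact_mod_cast hr0
  have h3 : ‖p.changeOrigin (y - x) n‖ ≤ T / (r : ℝ) ^ n := (le_div_iff₀ (pow_pos hr0' n)).2 h2
  calc (n.factorial : ℝ) * ‖p.changeOrigin (y - x) n fun _ => v‖
      ≤ n.factorial * (T / (r : ℝ) ^ n * ‖v‖ ^ n) := by
        gcongr
        exact h1.trans (by gcongr)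
    _ = T * n.factorial * (‖v‖ / r) ^ n := by
        rw [div_pow]; ring

/-- Admitting some C and M passes to subsets and to unions of two sets (take maxima), so compactness
globalizes the local estimate. -/
lemma IsCompact.exists_norm_iteratedFDeriv_le {f : E → F} {K : Set E} (hK : IsCompact K)
    (hf : AnalyticOnNhd ℝ f K) (v : E) :
    ∃ C M : ℝ, 0 ≤ C ∧ 0 ≤ M ∧ ∀ y ∈ K, ∀ n : ℕ,
      ‖iteratedFDeriv ℝ n f y fun _ => v‖ ≤ C * n.factorial * M ^ n := by
  refine hK.induction_on (p := fun s => ∃ C M : ℝ, 0 ≤ C ∧ 0 ≤ M ∧ ∀ y ∈ s, ∀ n : ℕ,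
    ‖iteratedFDeriv ℝ n f y fun _ => v‖ ≤ C * n.factorial * M ^ n) ⟨0, 0, le_rfl, le_rfl, by simp⟩
    ?_ ?_ ?_
  · rintro s t hst ⟨C, M, hC, hM, h⟩
    exact ⟨C, M, hC, hM, fun y hy => h y (hst hy)⟩
  · rintro s t ⟨C, M, hC, hM, h⟩ ⟨C', M', hC', hM', h'⟩
    refine ⟨max C C', max M M', le_max_of_le_left hC, le_max_of_le_left hM, ?_⟩
    rintro y (hy | hy) n
    · refine (h y hy n).trans ?_
      gcongr
      exacts [le_max_left _ _, le_max_left _ _]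
    · refine (h' y hy n).trans ?_
      gcongr
      exacts [le_max_right _ _, le_max_right _ _]
  · intro x hx
    obtain ⟨C, M, hC, hM, h⟩ := (hf x hx).exists_norm_iteratedFDeriv_le v
    exact ⟨_, mem_nhdsWithin_of_mem_nhds h, C, M, hC, hM, fun y hy => hy⟩

/-- A series of power series whose norms are jointly summable is a power series. -/
lemma HasFPowerSeriesOnBall.tsum {ι : Type*} {f : ι → E → F}
    {p : ι → FormalMultilinearSeries ℝ E F} {x : E} {r : NNReal} (hr : 0 < r)
    (hf : ∀ i, HasFPowerSeriesOnBall (f i) (p i) x r)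
    (hs : Summable fun q : ι × ℕ => ‖p q.1 q.2‖ * (r : ℝ) ^ q.2) :
    HasFPowerSeriesOnBall (fun y => ∑' i, f i y) (fun n => ∑' i, p i n) x r := by
  have hs' : Summable fun q : ℕ × ι => ‖p q.2 q.1‖ * (r : ℝ) ^ q.1 :=
    (Equiv.prodComm ℕ ι).summable_iff.2 hs
  have hr' : (0 : ℝ) < r := by exact_mod_cast hr
  have hfib : ∀ n, Summable fun i => ‖p i n‖ := fun n => by
    have := (hs'.prod_factor n).mul_right (((r : ℝ) ^ n)⁻¹)
    refine this.congr fun i => ?_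
    simp only [mul_assoc]
    rw [mul_inv_cancel₀ (pow_pos hr' n).ne', mul_one]
  refine ⟨?_, by exact_mod_cast hr, ?_⟩
  · refine FormalMultilinearSeries.le_radius_of_summable_norm _ ?_
    refine Summable.of_nonneg_of_le (fun n => by positivity) (fun n => ?_) hs'.prod
    change _ ≤ ∑' i, ‖p i n‖ * (r : ℝ) ^ n
    rw [tsum_mul_right]
    gcongr
    exact norm_tsum_le_tsum_norm (hfib n)
  · intro y hy
    have hy' : ‖y‖ ≤ r := by
      have := Metric.mem_eball.1 hy
      rw [edist_zero_right, enorm_eq_nnnorm] at this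
      exact_mod_cast this.le
    have hle : ∀ q : ι × ℕ, ‖p q.1 q.2 fun _ => y‖ ≤ ‖p q.1 q.2‖ * (r : ℝ) ^ q.2 := fun q => by
      refine ((p q.1 q.2).le_opNorm _).trans ?_
      simp only [Finset.prod_const, Finset.card_univ, Fintype.card_fin]
      gcongr
    have hsum : Summable fun q : ι × ℕ => p q.1 q.2 fun _ => y :=
      Summable.of_norm_bounded hs hle
    -- Absolute joint summability allows both orders: degrees first yields the functions, indices
    -- first yields the new power series.
    have h1 : HasSum (fun i => f i (x + y)) (∑' q : ι × ℕ, p q.1 q.2 fun _ => y) :=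
      hsum.hasSum.prod_fiberwise fun i => (hf i).hasSum hy
    have h2 := (Equiv.prodComm ℕ ι).hasSum_iff.2 hsum.hasSum
    rw [h1.tsum_eq]
    refine h2.prod_fiberwise fun n => ?_
    have h3 : Summable fun i => p i n := Summable.of_norm (hfib n)
    have h4 := h3.hasSum.mapL (ContinuousMultilinearMap.apply ℝ (fun _ : Fin n => E) F fun _ => y)
    exact h4

end PowerSeries

/-! ### Plane waves and exponential decay of coefficients -/

/-- The linear functional `k ↦ i R · k`. -/
def waveForm (a : Fin 2 → Plane) (m : Fin 2 → ℤ) : Plane →L[ℝ] ℂ :=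
  Complex.I • Complex.ofRealCLM ∘L innerSL ℝ (latticeVec a m)

lemma waveForm_apply (a : Fin 2 → Plane) (m : Fin 2 → ℤ) (k : Plane) :
    waveForm a m k = Complex.I * (inner ℝ (latticeVec a m) k : ℂ) := rfl

lemma norm_waveForm_le (a : Fin 2 → Plane) (m : Fin 2 → ℤ) :
    ‖waveForm a m‖ ≤ ‖latticeVec a m‖ := by
  refine ContinuousLinearMap.opNorm_le_bound _ (norm_nonneg _) fun k => ?_
  rw [waveForm_apply, norm_mul, Complex.norm_I, one_mul, Complex.norm_real]
  exact norm_inner_le_norm _ _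

lemma planeWave_eq_exp (a : Fin 2 → Plane) (m : Fin 2 → ℤ) :
    planeWave a m = fun k => Complex.exp (waveForm a m k) := rfl

lemma norm_planeWave (a : Fin 2 → Plane) (m : Fin 2 → ℤ) (k : Plane) : ‖planeWave a m k‖ = 1 := by
  rw [planeWave, mul_comm, Complex.norm_exp_ofReal_mul_I]

lemma contDiff_planeWave (a : Fin 2 → Plane) (m : Fin 2 → ℤ) {n : WithTop ℕ∞} :
    ContDiff ℝ n (planeWave a m) :=
  (waveForm a m).contDiff.cexp

lemma hasFDerivAt_planeWave (a : Fin 2 → Plane) (m : Fin 2 → ℤ) (k : Plane) :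
    HasFDerivAt (planeWave a m) (planeWave a m k • waveForm a m) k :=
  (waveForm a m).hasFDerivAt.cexp

lemma waveForm_neg (a : Fin 2 → Plane) (m : Fin 2 → ℤ) : waveForm a (-m) = -waveForm a m := by
  have : latticeVec a (-m) = - latticeVec a m := by
    simp [latticeVec_apply]; abel
  ext k
  rw [waveForm_apply, this, inner_neg_left]
  simp [waveForm_apply]

lemma scalarCoeff_eq (a b : Fin 2 → Plane) (f : Plane → ℂ) (m : Fin 2 → ℤ) :
    scalarCoeff a b f m = cellMean a b fun k => planeWave a (-m) k * f k := by
  simp only [scalarCoeff, IsReciprocalPair.planeWave_neg]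

namespace IsReciprocalPair

variable {a b : Fin 2 → Plane}

/-- The derivative of the periodic function e^{-iR·k} f has mean zero; expand it by the product
rule. -/
lemma scalarCoeff_fderiv (hab : IsReciprocalPair a b) {f : Plane → ℂ} (hf : IsLatticePeriodic b f)
    (hc : ContDiff ℝ 1 f) (v : Plane) (m : Fin 2 → ℤ) :
    scalarCoeff a b (fun k => fderiv ℝ f k v) m = waveForm a m v * scalarCoeff a b f m := by
  simp only [scalarCoeff_eq]
  have h0 := hab.cellMean_fderiv ((hab.planeWave_periodic (-m)).comp₂ hf (· * ·))
    ((contDiff_planeWave a (-m)).mul hc) v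
  have h1 : ∀ k, fderiv ℝ (fun k => planeWave a (-m) k * f k) k v =
      planeWave a (-m) k * fderiv ℝ f k v - waveForm a m v * (planeWave a (-m) k * f k) := by
    intro k
    have : fderiv ℝ (fun k => planeWave a (-m) k * f k) k = _ :=
      ((hasFDerivAt_planeWave a (-m) k).mul (hc.differentiable one_ne_zero k).hasFDerivAt).fderiv
    rw [this, waveForm_neg]
    simp
    ring
  simp only [h1] at h0
  have hd : Continuous fun k => fderiv ℝ f k v :=
    (hc.continuous_fderiv one_ne_zero).clm_apply continuous_const
  have hw : Continuous (planeWave a (-m)) := (contDiff_planeWave a (-m) (n := 0)).continuous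
  have hf' := hc.continuous
  rw [hab.cellMean_sub (by fun_prop) (by fun_prop),
    hab.cellMean_const_mul, sub_eq_zero] at h0
  exact h0

lemma scalarCoeff_pd (hab : IsReciprocalPair a b) {f : Plane → ℂ} (hf : IsLatticePeriodic b f)
    (hc : ContDiff ℝ 1 f) (j : Fin 2) (m : Fin 2 → ℤ) :
    scalarCoeff a b (pd j f) m = Complex.I * (latticeVec a m j : ℂ) * scalarCoeff a b f m := by
  have h := hab.scalarCoeff_fderiv hf hc (EuclideanSpace.single j 1) m
  rwa [waveForm_apply, EuclideanSpace.inner_single_right, one_mul, conj_trivial] at h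

lemma norm_scalarCoeff_le (hab : IsReciprocalPair a b) {f : Plane → ℂ} {C : ℝ}
    (hC : ∀ k, ‖f k‖ ≤ C) (m : Fin 2 → ℤ) : ‖scalarCoeff a b f m‖ ≤ C := by
  rw [scalarCoeff_eq]
  refine hab.norm_cellMean_le fun k => ?_
  rw [norm_mul, norm_planeWave, one_mul]
  exact hC k

lemma inner_latticeVec_right (hab : IsReciprocalPair a b) (m : Fin 2 → ℤ) (i : Fin 2) :
    inner ℝ (latticeVec a m) (b i) = 2 * Real.pi * m i := by
  simp only [latticeVec_apply, inner_add_left, inner_smul_left, hab.inner_eq]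
  fin_cases i <;> simp [mul_comm]

end IsReciprocalPair

lemma contDiff_iteratedFDeriv_apply {f : Plane → ℂ} (hf : ContDiff ℝ ⊤ f) (v : Plane) (n : ℕ) :
    ContDiff ℝ ⊤ fun k => iteratedFDeriv ℝ n f k fun _ => v := by
  have h : ContDiff ℝ ⊤ (iteratedFDeriv ℝ n f) := hf.iteratedFDeriv_right le_rfl
  exact (ContinuousMultilinearMap.apply ℝ (fun _ : Fin n => Plane) ℂ fun _ => v).contDiff.comp h

lemma IsLatticePeriodic.iteratedFDeriv {b : Fin 2 → Plane} {f : Plane → ℂ}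
    (hf : IsLatticePeriodic b f) (n : ℕ) : IsLatticePeriodic b (iteratedFDeriv ℝ n f) :=
  fun k G hG => by
    rw [← iteratedFDeriv_comp_add_right]
    congr 1
    exact funext fun q => hf q G hG

namespace IsReciprocalPair

variable {a b : Fin 2 → Plane}

lemma scalarCoeff_iteratedFDeriv (hab : IsReciprocalPair a b) {f : Plane → ℂ}
    (hf : IsLatticePeriodic b f) (hc : ContDiff ℝ ⊤ f) (v : Plane) (m : Fin 2 → ℤ) (n : ℕ) :
    scalarCoeff a b (fun k => iteratedFDeriv ℝ n f k fun _ => v) m =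
      waveForm a m v ^ n * scalarCoeff a b f m := by
  induction n with
  | zero => simp
  | succ n ih =>
    have h1 : ∀ k, (iteratedFDeriv ℝ (n + 1) f k fun _ => v) =
        fderiv ℝ (fun k => iteratedFDeriv ℝ n f k fun _ => v) k v := by
      intro k
      rw [iteratedFDeriv_succ_apply_left]
      have hd : DifferentiableAt ℝ (iteratedFDeriv ℝ n f) k :=
        (hc.iteratedFDeriv_right (m := ⊤) le_rfl).differentiable (by simp) k
      have := ((ContinuousMultilinearMap.apply ℝ (fun _ : Fin n => Plane) ℂ
        fun _ => v).hasFDerivAt.comp k hd.hasFDerivAt).fderiv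
      exact (congrArg (fun L : Plane →L[ℝ] ℂ => L v) this).symm
    simp only [h1]
    rw [hab.scalarCoeff_fderiv ((hf.iteratedFDeriv n).comp fun L => L fun _ => v)
      ((contDiff_iteratedFDeriv_apply hc v n).of_le le_top), ih]
    ring

lemma exists_norm_iteratedFDeriv_le (hab : IsReciprocalPair a b) {f : Plane → ℂ}
    (hf : IsLatticePeriodic b f) (hc : ContDiff ℝ ⊤ f) (v : Plane) :
    ∃ C M : ℝ, 0 ≤ C ∧ 0 ≤ M ∧ ∀ k, ∀ n : ℕ,
      ‖iteratedFDeriv ℝ n f k fun _ => v‖ ≤ C * n.factorial * M ^ n := by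
  have hK : IsCompact (cellMap b '' Set.Icc (fun _ => -(1 / 2)) fun _ => 1 / 2) :=
    isCompact_Icc.image (cellMap b).continuous
  obtain ⟨C, M, hC, hM, h⟩ := hK.exists_norm_iteratedFDeriv_le
    ((contDiff_omega_iff_analyticOnNhd.1 hc).mono (Set.subset_univ _)) v
  refine ⟨C, M, hC, hM, fun k n => ?_⟩
  obtain ⟨r, rfl⟩ := cellMap_surjective hab.cellDet_right k
  rw [← torusLift_coe (hf.iteratedFDeriv n)]
  refine h _ ⟨_, ?_, rfl⟩ n
  have hmem : ∀ t : UnitAddCircle, -(1 / 2) ≤ (AddCircle.equivIoc (1 : ℝ) (-(1 / 2)) t).1 ∧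
      (AddCircle.equivIoc (1 : ℝ) (-(1 / 2)) t).1 ≤ 1 / 2 := fun t => by
    have := (AddCircle.equivIoc (1 : ℝ) (-(1 / 2)) t).2
    exact ⟨this.1.le, this.2.trans (by norm_num)⟩
  exact ⟨fun i => (hmem _).1, fun i => (hmem _).2⟩

/-- Fourier coefficients of an analytic function decay exponentially. -/
lemma exists_norm_scalarCoeff_mul_exp_le (hab : IsReciprocalPair a b) {f : Plane → ℂ}
    (hf : IsLatticePeriodic b f) (hc : ContDiff ℝ ⊤ f) (i : Fin 2) :
    ∃ C ε : ℝ, 0 < ε ∧ ∀ m, ‖scalarCoeff a b f m‖ * Real.exp (ε * |(m i : ℝ)|) ≤ C := by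
  obtain ⟨C, M, hC, hM, h⟩ := hab.exists_norm_iteratedFDeriv_le hf hc (b i)
  -- With this rate 2π|m_i| = 2(M+1)t, so the n-th Cauchy estimate reads ‖c_m‖ tⁿ/n! ≤ C·2⁻ⁿ.
  -- Summing over n gives ‖c_m‖eᵗ ≤ 2C. The `+ 1` avoids division by zero.
  refine ⟨C * 2, Real.pi / (M + 1), by positivity, fun m => ?_⟩
  set t := Real.pi / (M + 1) * |(m i : ℝ)| with ht
  have hn : ∀ n : ℕ, ‖scalarCoeff a b f m‖ * (t ^ n / n.factorial) ≤ C * (1 / 2) ^ n := by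
    intro n
    have h1 := hab.norm_scalarCoeff_le (fun k => h k n) m
    rw [hab.scalarCoeff_iteratedFDeriv hf hc, norm_mul, norm_pow, waveForm_apply,
      hab.inner_latticeVec_right, norm_mul, Complex.norm_I, one_mul, Complex.norm_real,
      Real.norm_eq_abs, abs_mul, abs_of_pos Real.two_pi_pos] at h1
    have h2 : 2 * Real.pi * |(m i : ℝ)| = 2 * (M + 1) * t := by
      rw [ht]; field_simp
    rw [h2] at h1
    have h3 : C * n.factorial * M ^ n ≤ C * n.factorial * (M + 1) ^ n := by
      gcongr; linarith
    have h4 : (2 * (M + 1) * t) ^ n = (2 ^ n * t ^ n) * (M + 1) ^ n := by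
      rw [mul_pow, mul_pow]; ring
    rw [h4, mul_right_comm] at h1
    have h5 := le_of_mul_le_mul_right
      (show (2 ^ n * t ^ n * ‖scalarCoeff a b f m‖) * (M + 1) ^ n ≤
        C * n.factorial * (M + 1) ^ n by linarith) (by positivity)
    rw [one_div, inv_pow, ← div_eq_mul_inv, le_div_iff₀ (by positivity), ← mul_div_assoc,
      div_mul_eq_mul_div, div_le_iff₀ (by positivity)]
    linarith
  have hexp : HasSum (fun n : ℕ => t ^ n / n.factorial) (Real.exp t) := by
    rw [Real.exp_eq_exp_ℝ]
    exact NormedSpace.expSeries_div_hasSum_exp t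
  exact hasSum_le hn (hexp.mul_left _) (hasSum_geometric_two.mul_left C)

end IsReciprocalPair

/-- The size `|m₀| + |m₁|` of an integer vector. -/
def latticeSize (m : Fin 2 → ℤ) : ℝ := |(m 0 : ℝ)| + |(m 1 : ℝ)|

lemma latticeSize_nonneg (m : Fin 2 → ℤ) : 0 ≤ latticeSize m :=
  add_nonneg (abs_nonneg _) (abs_nonneg _)

lemma norm_latticeVec_le (a : Fin 2 → Plane) (m : Fin 2 → ℤ) :
    ‖latticeVec a m‖ ≤ (‖a 0‖ + ‖a 1‖) * latticeSize m := by
  rw [latticeVec_apply]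
  refine (norm_add_le _ _).trans ?_
  rw [norm_smul, norm_smul, Real.norm_eq_abs, Real.norm_eq_abs, latticeSize]
  nlinarith [mul_nonneg (norm_nonneg (a 0)) (abs_nonneg (m 1 : ℝ)),
    mul_nonneg (norm_nonneg (a 1)) (abs_nonneg (m 0 : ℝ))]

lemma summable_exp_neg_latticeSize {δ : ℝ} (hδ : 0 < δ) :
    Summable fun m : Fin 2 → ℤ => Real.exp (-(δ * latticeSize m)) := by
  have h1 : Summable fun n : ℤ => Real.exp (-(δ * |(n : ℝ)|)) := by
    have h2 : Summable fun n : ℕ => Real.exp (-(δ * n)) := by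
      have := Real.summable_exp_nat_mul_iff.2 (neg_lt_zero.2 hδ)
      refine this.congr fun n => ?_
      congr 1; ring
    refine Summable.of_nat_of_neg ?_ ?_ <;> simpa using h2
  have h3 := h1.mul_of_nonneg h1 (fun _ => (Real.exp_pos _).le) (fun _ => (Real.exp_pos _).le)
  refine ((finTwoArrowEquiv ℤ).summable_iff.2 h3).congr fun m => ?_
  change Real.exp (-(δ * |(m 0 : ℝ)|)) * Real.exp (-(δ * |(m 1 : ℝ)|)) = _
  rw [← Real.exp_add, latticeSize]
  congr 1; ring

/-- Exponentially decaying coefficients. -/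
def IsExpSummable (c : (Fin 2 → ℤ) → ℂ) : Prop :=
  ∃ δ > 0, Summable fun m => ‖c m‖ * Real.exp (δ * latticeSize m)

/-- The larger of |m₀|, |m₁| is at least half of `latticeSize m`, so decay in each coordinate gives
decay at rate ε/2 in the size. Half of that rate becomes the weight, the other half makes the sum
converge. -/
lemma IsReciprocalPair.isExpSummable_scalarCoeff {a b : Fin 2 → Plane} (hab : IsReciprocalPair a b)
    {f : Plane → ℂ} (hf : IsLatticePeriodic b f) (hc : ContDiff ℝ ⊤ f) :
    IsExpSummable (scalarCoeff a b f) := by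
  obtain ⟨C₀, ε₀, h₀, H₀⟩ := hab.exists_norm_scalarCoeff_mul_exp_le hf hc 0
  obtain ⟨C₁, ε₁, h₁, H₁⟩ := hab.exists_norm_scalarCoeff_mul_exp_le hf hc 1
  set ε := min ε₀ ε₁ with hε
  have hε0 : 0 < ε := lt_min h₀ h₁
  refine ⟨ε / 4, by positivity, Summable.of_nonneg_of_le (fun m => by positivity) (fun m => ?_)
    ((summable_exp_neg_latticeSize (δ := ε / 4) (by positivity)).mul_left (C₀ + C₁))⟩
  have key : ‖scalarCoeff a b f m‖ * Real.exp (ε / 2 * latticeSize m) ≤ C₀ + C₁ := by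
    have hC₀ : 0 ≤ C₀ := le_trans (by positivity) (H₀ m)
    have hC₁ : 0 ≤ C₁ := le_trans (by positivity) (H₁ m)
    rcases le_total |(m 0 : ℝ)| |(m 1 : ℝ)| with hle | hle
    · have : ε / 2 * latticeSize m ≤ ε₁ * |(m 1 : ℝ)| := by
        have h2 : ε * |(m 1 : ℝ)| ≤ ε₁ * |(m 1 : ℝ)| :=
          mul_le_mul_of_nonneg_right (min_le_right _ _) (abs_nonneg _)
        have h3 := mul_le_mul_of_nonneg_left hle hε0.le
        unfold latticeSize
        linarith
      calc _ ≤ ‖scalarCoeff a b f m‖ * Real.exp (ε₁ * |(m 1 : ℝ)|) := by gcongr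
        _ ≤ C₀ + C₁ := by linarith [H₁ m]
    · have : ε / 2 * latticeSize m ≤ ε₀ * |(m 0 : ℝ)| := by
        have h2 : ε * |(m 0 : ℝ)| ≤ ε₀ * |(m 0 : ℝ)| :=
          mul_le_mul_of_nonneg_right (min_le_left _ _) (abs_nonneg _)
        have h3 := mul_le_mul_of_nonneg_left hle hε0.le
        unfold latticeSize
        linarith
      calc _ ≤ ‖scalarCoeff a b f m‖ * Real.exp (ε₀ * |(m 0 : ℝ)|) := by gcongr
        _ ≤ C₀ + C₁ := by linarith [H₀ m]
  have hsplit : Real.exp (ε / 4 * latticeSize m) =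
      Real.exp (ε / 2 * latticeSize m) * Real.exp (-(ε / 4 * latticeSize m)) := by
    rw [← Real.exp_add]; congr 1; ring
  rw [hsplit, ← mul_assoc]
  gcongr

namespace IsExpSummable

variable {c : (Fin 2 → ℤ) → ℂ}

lemma summable_norm (hc : IsExpSummable c) : Summable fun m => ‖c m‖ := by
  obtain ⟨δ, hδ, h⟩ := hc
  refine Summable.of_nonneg_of_le (fun m => norm_nonneg _) (fun m => ?_) h
  exact le_mul_of_one_le_right (norm_nonneg _)
    (Real.one_le_exp (mul_nonneg hδ.le (latticeSize_nonneg m)))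

/-- Multipliers of linear growth preserve exponential decay. -/
lemma mul (hc : IsExpSummable c) {p : (Fin 2 → ℤ) → ℂ} {B : ℝ}
    (hp : ∀ m, ‖p m‖ ≤ B * (1 + latticeSize m)) : IsExpSummable fun m => p m * c m := by
  obtain ⟨δ, hδ, h⟩ := hc
  have hB : 0 ≤ B := by simpa [latticeSize] using (norm_nonneg _).trans (hp 0)
  -- Giving up half the rate pays for the linear factor, since x is at most (2/δ)e^{δx/2}.
  refine ⟨δ / 2, by positivity, Summable.of_nonneg_of_le (fun m => by positivity) (fun m => ?_)
    (h.mul_left (B * (1 + 2 / δ)))⟩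
  have hs := latticeSize_nonneg m
  have h1 : 1 + latticeSize m ≤ (1 + 2 / δ) * Real.exp (δ / 2 * latticeSize m) := by
    have h2 := Real.add_one_le_exp (δ / 2 * latticeSize m)
    have h3 : latticeSize m ≤ 2 / δ * (δ / 2 * latticeSize m + 1) := by
      have : 2 / δ * (δ / 2 * latticeSize m + 1) = latticeSize m + 2 / δ := by field_simp
      rw [this]
      have : 0 < 2 / δ := by positivity
      linarith
    have h4 : 2 / δ * (δ / 2 * latticeSize m + 1) ≤ 2 / δ * Real.exp (δ / 2 * latticeSize m) := by
      gcongr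
    have h5 : 0 ≤ δ / 2 * latticeSize m := by positivity
    linarith
  have h6 : Real.exp (δ * latticeSize m) =
      Real.exp (δ / 2 * latticeSize m) * Real.exp (δ / 2 * latticeSize m) := by
    rw [← Real.exp_add]; congr 1; ring
  rw [norm_mul, h6]
  calc ‖p m‖ * ‖c m‖ * Real.exp (δ / 2 * latticeSize m)
      ≤ (B * ((1 + 2 / δ) * Real.exp (δ / 2 * latticeSize m))) * ‖c m‖ *
        Real.exp (δ / 2 * latticeSize m) := by
        gcongr
        exact (hp m).trans (by gcongr)
    _ = _ := by ring

end IsExpSummable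

/-! ### Analyticity of Fourier series with exponentially decaying coefficients -/

/-- The Fourier series with coefficients `c`. -/
def waveSum (a : Fin 2 → Plane) (c : (Fin 2 → ℤ) → ℂ) (k : Plane) : ℂ :=
  ∑' m, c m * planeWave a m k

/-- The power series of `c · exp ∘ ℓ` at `x`, for a linear form `ℓ`. -/
def expFormSeries (ℓ : Plane →L[ℝ] ℂ) (z : ℂ) : FormalMultilinearSeries ℝ Plane ℂ := fun n =>
  (z / n.factorial) • (ContinuousMultilinearMap.mkPiAlgebraFin ℝ n ℂ).compContinuousLinearMap
    fun _ => ℓ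

lemma norm_expFormSeries_le (ℓ : Plane →L[ℝ] ℂ) (z : ℂ) (n : ℕ) :
    ‖expFormSeries ℓ z n‖ ≤ ‖z‖ * (‖ℓ‖ ^ n / n.factorial) := by
  rw [expFormSeries, norm_smul, norm_div, Complex.norm_natCast, div_mul_eq_mul_div, mul_div_assoc]
  have := (ContinuousMultilinearMap.mkPiAlgebraFin ℝ n ℂ).norm_compContinuousLinearMap_le
    fun _ => ℓ
  rw [ContinuousMultilinearMap.norm_mkPiAlgebraFin, one_mul, Finset.prod_const, Finset.card_univ,
    Fintype.card_fin] at this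
  gcongr

lemma hasFPowerSeriesOnBall_exp_form (ℓ : Plane →L[ℝ] ℂ) (c : ℂ) (x : Plane) {r : NNReal}
    (hr : 0 < r) :
    HasFPowerSeriesOnBall (fun k => c * Complex.exp (ℓ k))
      (expFormSeries ℓ (c * Complex.exp (ℓ x))) x r := by
  refine ⟨?_, by exact_mod_cast hr, ?_⟩
  · refine FormalMultilinearSeries.le_radius_of_summable_norm _ ?_
    refine Summable.of_nonneg_of_le (fun n => by positivity) (fun n => ?_)
      ((Real.summable_pow_div_factorial (‖ℓ‖ * r)).mul_left ‖c * Complex.exp (ℓ x)‖)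
    refine (mul_le_mul_of_nonneg_right (norm_expFormSeries_le _ _ n) (by positivity)).trans_eq ?_
    rw [mul_pow]; ring
  · intro y _
    have h : HasSum (fun n : ℕ => ℓ y ^ n / n.factorial) (Complex.exp (ℓ y)) := by
      rw [Complex.exp_eq_exp_ℂ]
      exact NormedSpace.expSeries_div_hasSum_exp (ℓ y)
    have h2 := h.mul_left (c * Complex.exp (ℓ x))
    rw [mul_assoc, ← Complex.exp_add, ← map_add] at h2
    refine h2.congr_fun fun n => ?_
    simp [expFormSeries, ContinuousMultilinearMap.mkPiAlgebraFin_apply]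
    ring

/-- Summing over n first produces w e^t. This is how the exponential weight controls all Taylor
coefficients of all waves jointly. -/
lemma summable_mul_pow_div_factorial {ι : Type*} {w t : ι → ℝ} (hw : ∀ i, 0 ≤ w i)
    (ht : ∀ i, 0 ≤ t i) (hs : Summable fun i => w i * Real.exp (t i)) :
    Summable fun q : ι × ℕ => w q.1 * (t q.1 ^ q.2 / q.2.factorial) := by
  have hexp : ∀ i, HasSum (fun n : ℕ => w i * (t i ^ n / n.factorial)) (w i * Real.exp (t i)) := by
    intro i
    rw [Real.exp_eq_exp_ℝ]
    exact (NormedSpace.expSeries_div_hasSum_exp (t i)).mul_left (w i)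
  have h0 : ∀ q : ι × ℕ, 0 ≤ w q.1 * (t q.1 ^ q.2 / q.2.factorial) := fun q =>
    mul_nonneg (hw _) (div_nonneg (pow_nonneg (ht _) _) (Nat.cast_nonneg _))
  exact (summable_prod_of_nonneg h0).2 ⟨fun i => (hexp i).summable,
    hs.congr fun i => (hexp i).tsum_eq.symm⟩

namespace IsExpSummable

variable {a : Fin 2 → Plane} {c : (Fin 2 → ℤ) → ℂ}

lemma summable_waveSum (hc : IsExpSummable c) (k : Plane) :
    Summable fun m => c m * planeWave a m k :=
  Summable.of_norm (hc.summable_norm.congr fun m => by rw [norm_mul, norm_planeWave, mul_one])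

/-- Each wave is a power series whose norms at radius r sum to at most ‖c_m‖e^{‖R‖r}. Taking r = δ/B
with ‖R‖ ≤ B·`latticeSize m` makes this at most the weighted coefficient, so the power series may be
added. -/
lemma analyticOnNhd_waveSum (hc : IsExpSummable c) :
    AnalyticOnNhd ℝ (waveSum a c) Set.univ := by
  intro x _
  obtain ⟨δ, hδ, hs⟩ := hc
  set B := ‖a 0‖ + ‖a 1‖ + 1 with hB
  have hB0 : 0 < B := by positivity
  obtain ⟨r, hr, hrB⟩ : ∃ r : NNReal, 0 < r ∧ (r : ℝ) = δ / B :=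
    ⟨⟨δ / B, by positivity⟩, div_pos hδ hB0, rfl⟩
  have hle : ∀ m, ‖waveForm a m‖ * r ≤ δ * latticeSize m := by
    intro m
    have h1 : ‖waveForm a m‖ ≤ B * latticeSize m :=
      ((norm_waveForm_le a m).trans (norm_latticeVec_le a m)).trans
        (mul_le_mul_of_nonneg_right (by rw [hB]; linarith) (latticeSize_nonneg m))
    rw [hrB]
    calc ‖waveForm a m‖ * (δ / B) ≤ B * latticeSize m * (δ / B) := by gcongr
      _ = δ * latticeSize m := by field_simp
  have hz : ∀ m, ‖c m * Complex.exp (waveForm a m x)‖ = ‖c m‖ := fun m => by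
    have := norm_planeWave a m x
    rw [planeWave_eq_exp] at this
    rw [norm_mul, this, mul_one]
  have hbd := summable_mul_pow_div_factorial (fun m => norm_nonneg (c m))
    (t := fun m => ‖waveForm a m‖ * r) (fun m => by positivity)
    (Summable.of_nonneg_of_le (fun m => by positivity)
      (fun m => mul_le_mul_of_nonneg_left (Real.exp_le_exp.2 (hle m)) (norm_nonneg (c m))) hs)
  have hs' : Summable fun q : (Fin 2 → ℤ) × ℕ =>
      ‖expFormSeries (waveForm a q.1) (c q.1 * Complex.exp (waveForm a q.1 x)) q.2‖ *
        (r : ℝ) ^ q.2 := by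
    refine Summable.of_nonneg_of_le (fun q => by positivity) (fun q => ?_) hbd
    refine (mul_le_mul_of_nonneg_right (norm_expFormSeries_le _ _ q.2) (by positivity)).trans_eq ?_
    rw [hz, mul_pow]; ring
  have key := HasFPowerSeriesOnBall.tsum (f := fun m k => c m * Complex.exp (waveForm a m k))
    (p := fun m => expFormSeries (waveForm a m) (c m * Complex.exp (waveForm a m x))) hr
    (fun m => hasFPowerSeriesOnBall_exp_form (waveForm a m) (c m) x hr) hs'
  exact key.analyticAt

lemma periodic_waveSum {b : Fin 2 → Plane} (hab : IsReciprocalPair a b) :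
    IsLatticePeriodic b (waveSum a c) := fun k G hG => by
  simp only [waveSum, hab.planeWave_periodic _ k G hG]

lemma coeff_pd (hc : IsExpSummable c) (j : Fin 2) :
    IsExpSummable fun m => Complex.I * (latticeVec a m j : ℂ) * c m := by
  refine hc.mul (B := ‖a 0‖ + ‖a 1‖) fun m => ?_
  rw [norm_mul, Complex.norm_I, one_mul, Complex.norm_real]
  refine ((PiLp.norm_apply_le (latticeVec a m) j).trans (norm_latticeVec_le a m)).trans ?_
  gcongr
  linarith

/-- Termwise differentiation is legitimate because the factor ‖R‖ grows linearly and is absorbed by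
the exponential decay. -/
lemma pd_waveSum (hc : IsExpSummable c) (j : Fin 2) :
    pd j (waveSum a c) = waveSum a fun m => Complex.I * (latticeVec a m j : ℂ) * c m := by
  ext k
  set B := ‖a 0‖ + ‖a 1‖ with hB
  have hnorm : ∀ m k, ‖c m • planeWave a m k • waveForm a m‖ ≤ B * (latticeSize m * ‖c m‖) := by
    intro m k
    rw [norm_smul, norm_smul, norm_planeWave, one_mul]
    have := (norm_waveForm_le a m).trans (norm_latticeVec_le a m)
    calc ‖c m‖ * ‖waveForm a m‖ ≤ ‖c m‖ * (B * latticeSize m) := by gcongr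
      _ = _ := by ring
  have hsum : Summable fun m => B * (latticeSize m * ‖c m‖) := by
    refine Summable.mul_left _ ?_
    have := (hc.mul (p := fun m => (latticeSize m : ℂ)) (B := 1) fun m => by
      rw [Complex.norm_real, Real.norm_of_nonneg (latticeSize_nonneg m)]; linarith).summable_norm
    refine this.congr fun m => ?_
    rw [norm_mul, Complex.norm_real, Real.norm_of_nonneg (latticeSize_nonneg m)]
  have h := hasFDerivAt_tsum hsum (fun m k => (hasFDerivAt_planeWave a m k).const_mul (c m))
    hnorm (hc.summable_waveSum 0) k
  have hs : Summable fun m => c m • planeWave a m k • waveForm a m :=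
    Summable.of_norm_bounded hsum fun m => hnorm m k
  have h2 : pd j (waveSum a c) k = _ := congrArg (fun L : Plane →L[ℝ] ℂ =>
    L (EuclideanSpace.single j 1)) h.fderiv
  rw [h2]
  have h3 := hs.hasSum.mapL (ContinuousLinearMap.apply ℝ ℂ
    (EuclideanSpace.single j (1 : ℝ) : Plane))
  refine h3.tsum_eq.symm.trans (tsum_congr fun m => ?_)
  have h4 : waveForm a m (EuclideanSpace.single j 1) = Complex.I * (latticeVec a m j : ℂ) := by
    rw [waveForm_apply, EuclideanSpace.inner_single_right, one_mul, conj_trivial]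
  simp only [ContinuousLinearMap.apply_apply, _root_.smul_apply, h4, smul_eq_mul]
  ring

end IsExpSummable

lemma pd_re {f : Plane → ℂ} (hf : Differentiable ℝ f) (j : Fin 2) :
    pd j (fun k => (f k).re) = fun k => (pd j f k).re := by
  ext k
  have := (Complex.reCLM.hasFDerivAt.comp k (hf k).hasFDerivAt).fderiv
  exact congrArg (fun L : Plane →L[ℝ] ℝ => L (EuclideanSpace.single j 1)) this

/-! ### Poisson's equation with analytic data -/

namespace IsReciprocalPair

variable {a b : Fin 2 → Plane}

lemma waveSum_scalarCoeff (hab : IsReciprocalPair a b) {f : Plane → ℂ}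
    (hf : IsLatticePeriodic b f) (hc : ContDiff ℝ ⊤ f) : waveSum a (scalarCoeff a b f) = f :=
  funext fun k => (hab.hasSum_scalarCoeff_mul_planeWave hf hc.continuous
    (hab.isExpSummable_scalarCoeff hf hc).summable_norm.of_norm k).tsum_eq

/-- Nonzero lattice vectors stay away from 0: if m_i ≠ 0, then R·b_i = 2πm_i forces 1 ≤ ‖R‖‖b_i‖. At
R = 0 the convention 0⁻¹ = 0 applies. -/
lemma exists_inv_norm_latticeVec_le (hab : IsReciprocalPair a b) :
    ∃ C, ∀ m, ‖((‖latticeVec a m‖ : ℂ) ^ 2)⁻¹‖ ≤ C := by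
  refine ⟨(‖b 0‖ + ‖b 1‖) ^ 2, fun m => ?_⟩
  rw [norm_inv, norm_pow, Complex.norm_real, norm_norm, ← inv_pow]
  gcongr
  by_cases hm : m = 0
  · have : latticeVec a m = 0 := by rw [hm, latticeVec_apply]; simp
    rw [this, norm_zero, inv_zero]
    positivity
  · have hi : ∃ i, m i ≠ 0 := by
      by_contra! h
      exact hm (funext h)
    obtain ⟨i, hi⟩ := hi
    have h1 : (1 : ℝ) ≤ |(m i : ℝ)| := by exact_mod_cast Int.one_le_abs hi
    have h2 := abs_real_inner_le_norm (latticeVec a m) (b i)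
    rw [hab.inner_latticeVec_right, abs_mul, abs_of_pos Real.two_pi_pos] at h2
    have h3 : ‖b i‖ ≤ ‖b 0‖ + ‖b 1‖ := by
      fin_cases i <;> simp
    have h4 : 1 ≤ ‖latticeVec a m‖ * (‖b 0‖ + ‖b 1‖) := by
      calc (1 : ℝ) ≤ 2 * Real.pi * |(m i : ℝ)| := by nlinarith [Real.pi_gt_three]
        _ ≤ _ := h2.trans (by gcongr)
    have h5 : 0 < ‖latticeVec a m‖ := by
      by_contra! h
      have : ‖latticeVec a m‖ = 0 := le_antisymm h (norm_nonneg _)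
      rw [this] at h4
      linarith
    rw [inv_le_iff_one_le_mul₀ h5]
    linarith

/-- Poisson's equation with analytic periodic right-hand side of mean zero has an analytic periodic
solution. -/
theorem exists_analytic_poisson (hab : IsReciprocalPair a b) {g : Plane → ℝ}
    (hg : IsLatticePeriodic b g) (hc : ContDiff ℝ ⊤ g) (h0 : cellMean a b g = 0) :
    ∃ f : Plane → ℝ, ContDiff ℝ ⊤ f ∧ IsLatticePeriodic b f ∧
      ∀ k, pd 0 (pd 0 f) k + pd 1 (pd 1 f) k = g k := by
  set G : Plane → ℂ := fun k => (g k : ℂ) with hGdef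
  have hG : IsLatticePeriodic b G := hg.comp _
  have hGc : ContDiff ℝ ⊤ G := Complex.ofRealCLM.contDiff.comp hc
  set c := scalarCoeff a b G with hcdef
  have hcs : IsExpSummable c := hab.isExpSummable_scalarCoeff hG hGc
  obtain ⟨C, hC⟩ := hab.exists_inv_norm_latticeVec_le
  have hC0 : 0 ≤ C := (norm_nonneg _).trans (hC 0)
  -- The Laplacian multiplies the coefficient at R by −‖R‖², so divide by it; 0⁻¹ = 0 sets the free
  -- coefficient at R = 0 to zero.
  set d : (Fin 2 → ℤ) → ℂ := fun m => -((‖latticeVec a m‖ : ℂ) ^ 2)⁻¹ * c m with hd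
  have hds : IsExpSummable d := hcs.mul (B := C) fun m => by
    rw [norm_neg]
    exact (hC m).trans (le_mul_of_one_le_right hC0 (by linarith [latticeSize_nonneg m]))
  have hdiff : ∀ {e : (Fin 2 → ℤ) → ℂ}, IsExpSummable e → ContDiff ℝ ⊤ (waveSum a e) :=
    fun he => contDiff_omega_iff_analyticOnNhd.2 he.analyticOnNhd_waveSum
  have hpd : ∀ j, pd j (pd j fun k => (waveSum a d k).re) =
      fun k => (waveSum a (fun m => Complex.I * (latticeVec a m j : ℂ) *
        (Complex.I * (latticeVec a m j : ℂ) * d m)) k).re := by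
    intro j
    rw [pd_re ((hdiff hds).differentiable (by simp)), hds.pd_waveSum j,
      pd_re ((hdiff (hds.coeff_pd j)).differentiable (by simp)), (hds.coeff_pd j).pd_waveSum j]
  refine ⟨fun k => (waveSum a d k).re, Complex.reCLM.contDiff.comp (hdiff hds),
    (IsExpSummable.periodic_waveSum hab).comp _, fun k => ?_⟩
  rw [hpd 0, hpd 1]
  change (waveSum a _ k).re + (waveSum a _ k).re = g k
  rw [← Complex.add_re]
  have hs0 := (((hds.coeff_pd (a := a) 0).coeff_pd (a := a) 0).summable_waveSum (a := a) k)
  have hs1 := (((hds.coeff_pd (a := a) 1).coeff_pd (a := a) 1).summable_waveSum (a := a) k)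
  have : waveSum a c k = G k := congrFun (hab.waveSum_scalarCoeff hG hGc) k
  rw [waveSum, waveSum, ← hs0.tsum_add hs1]
  refine (congrArg Complex.re (Eq.trans (tsum_congr fun m => ?_) this)).trans (Complex.ofReal_re _)
  by_cases hm : latticeVec a m = 0
  · have hm0 : m = 0 := by
      have := cellMap_injective hab.cellDet_left (hm.trans (map_zero (cellMap a)).symm)
      ext i
      exact Int.cast_eq_zero.1 (congrFun this i)
    -- The one coefficient that cannot be divided is the mean of g, which vanishes.
    have hc0 : c m = 0 := by
      have h1 : cellMean a b G = ((cellMean a b g : ℝ) : ℂ) :=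
        hab.cellMean_clm Complex.ofRealCLM hc.continuous
      rw [hcdef, scalarCoeff, hm]
      simp only [inner_zero_left, Complex.ofReal_zero, mul_zero, Complex.exp_zero, one_mul]
      exact h1.trans (by rw [h0, Complex.ofReal_zero])
    simp [hd, hc0]
  · have hn : (‖latticeVec a m‖ : ℂ) ^ 2 ≠ 0 := by
      simpa using hm
    have hn2 : (‖latticeVec a m‖ : ℂ) ^ 2 =
        (latticeVec a m 0 : ℂ) ^ 2 + (latticeVec a m 1 : ℂ) ^ 2 := by
      exact_mod_cast norm_sq_plane (latticeVec a m)
    have hI := Complex.I_sq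
    simp only [hd]
    rw [← add_mul]
    congr 1
    have he := inv_mul_cancel₀ hn
    generalize (‖latticeVec a m‖ : ℂ) ^ 2 = N at *
    linear_combination (-((latticeVec a m 0 : ℂ) ^ 2 + (latticeVec a m 1 : ℂ) ^ 2) * N⁻¹ * c m) * hI
      + c m * he - N⁻¹ * c m * hn2

end IsReciprocalPair

/-! ### Calculus of partial derivatives -/

section Calculus

variable {X : Type*} [NormedAddCommGroup X] [NormedSpace ℝ X]

lemma fderiv_eq_pd (f : Plane → X) (k v : Plane) :
    fderiv ℝ f k v = v 0 • pd 0 f k + v 1 • pd 1 f k := by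
  have : v = v 0 • EuclideanSpace.single 0 1 + v 1 • EuclideanSpace.single 1 1 := by
    ext i; fin_cases i <;> simp
  conv_lhs => rw [this]
  rw [map_add, map_smul, map_smul]
  rfl

lemma eq_of_pd_eq_zero {f : Plane → X} (hf : Differentiable ℝ f) (h : ∀ j k, pd j f k = 0)
    (k q : Plane) : f k = f q := by
  refine is_const_of_fderiv_eq_zero (𝕜 := ℝ) hf (fun x => ?_) k q
  ext v
  rw [fderiv_eq_pd, h, h]
  simp

lemma contDiff_pd {f : Plane → X} {m n : WithTop ℕ∞} (hf : ContDiff ℝ n f) (hmn : m + 1 ≤ n)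
    (j : Fin 2) : ContDiff ℝ m (pd j f) :=
  (hf.fderiv_right hmn).clm_apply contDiff_const

lemma pd_add {f g : Plane → X} {k : Plane} (hf : DifferentiableAt ℝ f k)
    (hg : DifferentiableAt ℝ g k) (j : Fin 2) :
    pd j (fun q => f q + g q) k = pd j f k + pd j g k := by
  simp only [pd, fderiv_fun_add hf hg]
  rfl

lemma pd_sub {f g : Plane → X} {k : Plane} (hf : DifferentiableAt ℝ f k)
    (hg : DifferentiableAt ℝ g k) (j : Fin 2) :
    pd j (fun q => f q - g q) k = pd j f k - pd j g k := by
  simp only [pd, fderiv_fun_sub hf hg]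
  rfl

lemma pd_neg (f : Plane → X) (k : Plane) (j : Fin 2) :
    pd j (fun q => -f q) k = -pd j f k := by
  simp only [pd, fderiv_fun_neg]
  rfl

lemma pd_const (x : X) (k : Plane) (j : Fin 2) : pd j (fun _ => x) k = 0 := by
  simp [pd]

lemma pd_smul {𝕜 : Type*} [NontriviallyNormedField 𝕜] [NormedAlgebra ℝ 𝕜] [NormedSpace 𝕜 X]
    [IsScalarTower ℝ 𝕜 X] {c : Plane → 𝕜} {f : Plane → X} {k : Plane} (hc : DifferentiableAt ℝ c k)
    (hf : DifferentiableAt ℝ f k) (j : Fin 2) :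
    pd j (fun q => c q • f q) k = c k • pd j f k + pd j c k • f k := by
  simp only [pd, fderiv_fun_smul hc hf]
  rfl

lemma pd_mul {𝕜 : Type*} [RCLike 𝕜] {f g : Plane → 𝕜} {k : Plane} (hf : DifferentiableAt ℝ f k)
    (hg : DifferentiableAt ℝ g k) (j : Fin 2) :
    pd j (fun q => f q * g q) k = f k * pd j g k + pd j f k * g k :=
  pd_smul hf hg j

lemma pd_pd_comm {f : Plane → X} (hf : ContDiff ℝ 2 f) (k : Plane) (i j : Fin 2) :
    pd i (pd j f) k = pd j (pd i f) k := by
  have h : ∀ i j : Fin 2, pd i (pd j f) k =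
      fderiv ℝ (fderiv ℝ f) k (EuclideanSpace.single i 1) (EuclideanSpace.single j 1) := by
    intro i j
    have hd : DifferentiableAt ℝ (fderiv ℝ f) k :=
      (hf.fderiv_right (m := 1) (by norm_num)).differentiable one_ne_zero k
    have := ((ContinuousLinearMap.apply ℝ X
      (EuclideanSpace.single j (1 : ℝ) : Plane)).hasFDerivAt.comp k hd.hasFDerivAt).fderiv
    exact congrArg (fun L : Plane →L[ℝ] X => L (EuclideanSpace.single i 1)) this
  rw [h, h]
  exact (hf.contDiffAt.isSymmSndFDerivAt (by simp)).eq _ _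

end Calculus

/-! ### Integration by parts and div–curl rigidity -/

namespace IsReciprocalPair

variable {a b : Fin 2 → Plane}

/-- Integration by parts on the torus. -/
lemma cellMean_mul_pd (hab : IsReciprocalPair a b) {f g : Plane → ℝ} (hf : IsLatticePeriodic b f)
    (hg : IsLatticePeriodic b g) (hfc : ContDiff ℝ 1 f) (hgc : ContDiff ℝ 1 g) (j : Fin 2) :
    cellMean a b (fun k => f k * pd j g k) = -cellMean a b fun k => pd j f k * g k := by
  have h := hab.cellMean_pd (hf.comp₂ hg (· * ·)) (hfc.mul hgc) j
  have h2 : pd j (fun k => f k * g k) = fun k => f k * pd j g k + pd j f k * g k :=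
    funext fun k => pd_mul (hfc.differentiable one_ne_zero k) (hgc.differentiable one_ne_zero k) j
  rw [h2] at h
  have h3 := hfc.continuous
  have h4 := hgc.continuous
  have h5 := (contDiff_pd hfc (m := 0) (by norm_num) j).continuous
  have h6 := (contDiff_pd hgc (m := 0) (by norm_num) j).continuous
  rw [hab.cellMean_add (by fun_prop) (by fun_prop)] at h
  exact eq_neg_of_add_eq_zero_left h

/-- Periodic harmonic functions are constant. -/
lemma eq_of_laplacian_eq_zero (hab : IsReciprocalPair a b) {f : Plane → ℝ}
    (hf : IsLatticePeriodic b f) (hfc : ContDiff ℝ 2 f)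
    (h : ∀ k, pd 0 (pd 0 f) k + pd 1 (pd 1 f) k = 0) :
    ∀ j k, pd j f k = 0 := by
  have h1 : ContDiff ℝ 1 f := hfc.of_le (by norm_num)
  have hp : ∀ j, ContDiff ℝ 1 (pd j f) := fun j => contDiff_pd hfc (by norm_num) j
  have hpp : ∀ j, Continuous (pd j (pd j f)) := fun j =>
    (contDiff_pd (hp j) (m := 0) (by norm_num) j).continuous
  have hc := hfc.continuous
  have hpc := fun j => (hp j).continuous
  -- Green's identity: the mean of fΔf is minus the mean of |∇f|², so Δf = 0 forces ∇f = 0.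
  have e : ∀ j, cellMean a b (fun k => f k * pd j (pd j f) k) =
      -cellMean a b fun k => pd j f k ^ 2 := fun j => by
    rw [hab.cellMean_mul_pd hf (hf.pd j) h1 (hp j)]
    simp only [sq]
  have hz : cellMean a b (fun k => f k * pd 0 (pd 0 f) k + f k * pd 1 (pd 1 f) k) = 0 := by
    simp only [← mul_add, h, mul_zero]
    exact hab.cellMean_const 0
  have := hpp 0
  have := hpp 1
  have := hpc 0
  have := hpc 1
  rw [hab.cellMean_add (by fun_prop) (by fun_prop), e, e, ← neg_add, neg_eq_zero,
    ← hab.cellMean_add (by fun_prop) (by fun_prop)] at hz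
  have key := hab.eq_zero_of_cellMean_eq_zero
    ((hf.pd 0).comp₂ (hf.pd 1) fun x y => x ^ 2 + y ^ 2) (by fun_prop)
    (fun k => by positivity) hz
  have h2 : ∀ k, pd 0 f k = 0 ∧ pd 1 f k = 0 := fun k => by
    have hk := key k
    constructor <;> nlinarith [sq_nonneg (pd 0 f k), sq_nonneg (pd 1 f k)]
  exact Fin.forall_fin_two.2 ⟨fun k => (h2 k).1, fun k => (h2 k).2⟩

/-- A periodic field that is both divergence-free and curl-free is constant. -/
lemma eq_of_divergence_curl_eq_zero (hab : IsReciprocalPair a b) {B₀ B₁ : Plane → ℝ}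
    (h₀ : IsLatticePeriodic b B₀) (h₁ : IsLatticePeriodic b B₁) (hc₀ : ContDiff ℝ 2 B₀)
    (hc₁ : ContDiff ℝ 2 B₁) (hdiv : ∀ k, pd 0 B₀ k + pd 1 B₁ k = 0)
    (hcurl : ∀ k, pd 0 B₁ k = pd 1 B₀ k) (k q : Plane) : B₀ k = B₀ q ∧ B₁ k = B₁ q := by
  have e1 : pd 0 B₀ = fun k => -pd 1 B₁ k := funext fun k => eq_neg_of_add_eq_zero_left (hdiv k)
  have e2 : pd 1 B₁ = fun k => -pd 0 B₀ k := funext fun k => eq_neg_of_add_eq_zero_right (hdiv k)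
  have e3 : pd 0 B₁ = pd 1 B₀ := funext hcurl
  constructor
  -- The two equations are of Cauchy–Riemann type, so each component is harmonic and hence constant.
  · refine eq_of_pd_eq_zero (hc₀.differentiable two_ne_zero)
      (hab.eq_of_laplacian_eq_zero h₀ hc₀ fun k => ?_) k q
    rw [e1, ← e3, pd_neg, pd_pd_comm hc₁]
    ring
  · refine eq_of_pd_eq_zero (hc₁.differentiable two_ne_zero)
      (hab.eq_of_laplacian_eq_zero h₁ hc₁ fun k => ?_) k q
    rw [e3, e2, pd_neg, pd_pd_comm hc₀]
    ring

/-- Rotated gradients are orthogonal to curl-free fields. -/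
lemma cellMean_rot_mul_eq_zero (hab : IsReciprocalPair a b) {F B₀ B₁ : Plane → ℝ}
    (hF : IsLatticePeriodic b F) (h₀ : IsLatticePeriodic b B₀) (h₁ : IsLatticePeriodic b B₁)
    (hFc : ContDiff ℝ 1 F) (hc₀ : ContDiff ℝ 1 B₀) (hc₁ : ContDiff ℝ 1 B₁)
    (hcurl : ∀ k, pd 0 B₁ k = pd 1 B₀ k) :
    cellMean a b (fun k => B₀ k * pd 1 F k - B₁ k * pd 0 F k) = 0 := by
  have := hFc.continuous
  have := hc₀.continuous
  have := hc₁.continuous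
  have := (contDiff_pd hFc (m := 0) (by norm_num) 0).continuous
  have := (contDiff_pd hFc (m := 0) (by norm_num) 1).continuous
  -- Parts move both derivatives off F and leave the mean of F times the curl of B.
  rw [hab.cellMean_sub (by fun_prop) (by fun_prop), hab.cellMean_mul_pd h₀ hF hc₀ hFc,
    hab.cellMean_mul_pd h₁ hF hc₁ hFc]
  simp only [hcurl, sub_self]

end IsReciprocalPair

/-! ### Hodge decomposition -/

section Hodge

variable {a b : Fin 2 → Plane} {A : Plane → Plane} {ψ F : Plane → ℝ} {h : Plane}

/-- The scalar potential of a Hodge decomposition solves Poisson's equation. -/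
lemma IsHodgeDecomposition.poisson (hd : IsHodgeDecomposition b A ψ F h) :
    IsPeriodicPoissonSolution b (divergence A) ψ := by
  refine ⟨hd.contDiff_ψ, hd.periodic_ψ, fun k => ?_⟩
  have hψ := fun j => (contDiff_pd hd.contDiff_ψ (m := 1) (by norm_num) j).differentiable
    one_ne_zero k
  have hF := fun j => (contDiff_pd hd.contDiff_F (m := 1) (by norm_num) j).differentiable
    one_ne_zero k
  have h0 : (fun q => A q 0) = fun q => (-pd 0 ψ q + pd 1 F q) + h 0 := funext fun q => by
    simp [hd.decomposition q, gradient2, rotGradient]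
  have h1 : (fun q => A q 1) = fun q => (-pd 1 ψ q - pd 0 F q) + h 1 := funext fun q => by
    simp [hd.decomposition q, gradient2, rotGradient, sub_eq_add_neg]
  rw [divergence, h0, h1, pd_add ((hψ 0).fun_neg.fun_add (hF 1)) (differentiableAt_const _),
    pd_add ((hψ 1).fun_neg.fun_sub (hF 0)) (differentiableAt_const _),
    pd_add (hψ 0).fun_neg (hF 1), pd_sub (hψ 1).fun_neg (hF 0), pd_const, pd_const, pd_neg, pd_neg,
    pd_pd_comm hd.contDiff_F k 0 1]
  ring

/-- Two periodic solutions of the same Poisson equation differ by a constant. -/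
lemma IsReciprocalPair.pd_eq_of_poisson (hab : IsReciprocalPair a b) {g ψ ψ' : Plane → ℝ}
    (hψ : IsPeriodicPoissonSolution b g ψ) (hψ' : IsPeriodicPoissonSolution b g ψ') (j : Fin 2)
    (k : Plane) : pd j ψ k = pd j ψ' k := by
  have hd := hψ.contDiff.differentiable two_ne_zero
  have hd' := hψ'.contDiff.differentiable two_ne_zero
  have h1 : ∀ j, pd j (fun k => ψ k - ψ' k) = fun k => pd j ψ k - pd j ψ' k := fun j =>
    funext fun k => pd_sub (hd k) (hd' k) j
  have h2 : ∀ j k, pd j (pd j fun k => ψ k - ψ' k) k = pd j (pd j ψ) k - pd j (pd j ψ') k := by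
    intro j k
    rw [h1]
    exact pd_sub ((contDiff_pd hψ.contDiff (m := 1) (by norm_num) j).differentiable one_ne_zero k)
      ((contDiff_pd hψ'.contDiff (m := 1) (by norm_num) j).differentiable one_ne_zero k) j
  have := hab.eq_of_laplacian_eq_zero (hψ.periodic.comp₂ hψ'.periodic (· - ·))
    (hψ.contDiff.sub hψ'.contDiff) (fun k => by
      rw [h2, h2]; linarith [hψ.poisson k, hψ'.poisson k]) j k
  rw [h1] at this
  exact sub_eq_zero.1 this

/-- Analytic periodic fields have an analytic Hodge decomposition. -/
theorem IsReciprocalPair.exists_hodge (hab : IsReciprocalPair a b)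
    (hA : IsLatticePeriodic b A) (hc : ∀ j, ContDiff ℝ ⊤ fun k => A k j) :
    ∃ (ψ F : Plane → ℝ) (h : Plane), ContDiff ℝ ⊤ ψ ∧ ContDiff ℝ ⊤ F ∧
      IsHodgeDecomposition b A ψ F h := by
  have hAj : ∀ j, IsLatticePeriodic b fun k => A k j := fun j => hA.comp fun x => x j
  have hp : ∀ i j, ContDiff ℝ ⊤ (pd i fun k => A k j) := fun i j =>
    contDiff_pd (hc j) (by simp) i
  have hpp : ∀ i j, IsLatticePeriodic b (pd i fun k => A k j) := fun i j => (hAj j).pd i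
  have h0 : ∀ i j, cellMean a b (pd i fun k => A k j) = 0 := fun i j =>
    hab.cellMean_pd (hAj j) ((hc j).of_le le_top) i
  have hz : cellMean a b (fun k => -(divergence A k)) = 0 := by
    have : (fun k => -(divergence A k)) = fun k =>
      (-1 : ℝ) * (pd 0 (fun q => A q 0) k + pd 1 (fun q => A q 1) k) := by
      ext k; rw [divergence]; ring
    rw [this, hab.cellMean_const_mul, hab.cellMean_add (hp 0 0).continuous (hp 1 1).continuous,
      h0, h0]
    simp
  -- Choose Δψ = −div A and ΔF = ∂_yA_x − ∂_xA_y. Then A + ∇ψ minus the rotated gradient of F is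
  -- both divergence-free and curl-free, hence the constant h. Both right-hand sides have mean zero,
  -- being sums of derivatives of periodic functions.
  obtain ⟨ψ, hψc, hψ, hψe⟩ := hab.exists_analytic_poisson
    (((hpp 0 0).comp₂ (hpp 1 1) (· + ·)).comp Neg.neg) ((hp 0 0).add (hp 1 1)).neg hz
  obtain ⟨F, hFc, hF, hFe⟩ := hab.exists_analytic_poisson
    ((hpp 1 0).comp₂ (hpp 0 1) (· - ·)) ((hp 1 0).sub (hp 0 1)) (by
      rw [hab.cellMean_sub (hp 1 0).continuous (hp 0 1).continuous, h0, h0, sub_zero])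
  have hdiff : ∀ {f : Plane → ℝ}, ContDiff ℝ ⊤ f → ∀ k, DifferentiableAt ℝ f k := fun hf k =>
    hf.differentiable (by simp) k
  have hψj : ∀ j, ContDiff ℝ ⊤ (pd j ψ) := fun j => contDiff_pd hψc (by simp) j
  have hFj : ∀ j, ContDiff ℝ ⊤ (pd j F) := fun j => contDiff_pd hFc (by simp) j
  have hconst := hab.eq_of_divergence_curl_eq_zero
    (B₀ := fun k => A k 0 + pd 0 ψ k - pd 1 F k) (B₁ := fun k => A k 1 + pd 1 ψ k + pd 0 F k)
    (((hAj 0).comp₂ (hψ.pd 0) (· + ·)).comp₂ (hF.pd 1) (· - ·))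
    (((hAj 1).comp₂ (hψ.pd 1) (· + ·)).comp₂ (hF.pd 0) (· + ·))
    ((((hc 0).add (hψj 0)).sub (hFj 1)).of_le le_top)
    ((((hc 1).add (hψj 1)).add (hFj 0)).of_le le_top)
    (fun k => by
      rw [pd_sub ((hdiff (hc 0) k).fun_add (hdiff (hψj 0) k)) (hdiff (hFj 1) k),
        pd_add (hdiff (hc 0) k) (hdiff (hψj 0) k),
        pd_add ((hdiff (hc 1) k).fun_add (hdiff (hψj 1) k)) (hdiff (hFj 0) k),
        pd_add (hdiff (hc 1) k) (hdiff (hψj 1) k), pd_pd_comm (hFc.of_le le_top) k 0 1]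
      linarith [hψe k])
    (fun k => by
      rw [pd_sub ((hdiff (hc 0) k).fun_add (hdiff (hψj 0) k)) (hdiff (hFj 1) k),
        pd_add (hdiff (hc 0) k) (hdiff (hψj 0) k),
        pd_add ((hdiff (hc 1) k).fun_add (hdiff (hψj 1) k)) (hdiff (hFj 0) k),
        pd_add (hdiff (hc 1) k) (hdiff (hψj 1) k), pd_pd_comm (hψc.of_le le_top) k 0 1]
      linarith [hFe k])
  refine ⟨ψ, F, !₂[A 0 0 + pd 0 ψ 0 - pd 1 F 0, A 0 1 + pd 1 ψ 0 + pd 0 F 0], hψc, hFc,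
    hψc.of_le le_top, hFc.of_le le_top, hψ, hF, fun k => ?_⟩
  obtain ⟨e0, e1⟩ := hconst k 0
  ext j
  fin_cases j
  · simp [gradient2, rotGradient]; linarith
  · simp [gradient2, rotGradient]; linarith

end Hodge

/-! ### Berry connections, projectors and gauge transformations -/

section Berry

variable {n : ℕ} {b : Fin 2 → Plane} {H : Plane → Matrix (Fin n) (Fin n) ℂ} {E : Plane → ℝ}
  {u v w : Plane → CVec n}

lemma pd_inner {f g : Plane → CVec n} {k : Plane} (hf : DifferentiableAt ℝ f k)
    (hg : DifferentiableAt ℝ g k) (j : Fin 2) :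
    pd j (fun q => inner ℂ (f q) (g q)) k =
      inner ℂ (f k) (pd j g k) + inner ℂ (pd j f k) (g k) :=
  fderiv_inner_apply ℂ hf hg _

lemma berryConnection_apply (v : Plane → CVec n) (k : Plane) (j : Fin 2) :
    berryConnection v k j = (Complex.I * inner ℂ (v k) (pd j v k)).re := by
  fin_cases j <;> rfl

/-- Bilinearity holds over ℝ only, the second slot being conjugate-linear over ℂ. It supplies the
product rule for vv*. -/
lemma isBoundedBilinearMap_rankOne :
    IsBoundedBilinearMap ℝ fun p : CVec n × CVec n => InnerProductSpace.rankOne ℂ p.1 p.2 where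
  add_left x₁ x₂ y := by ext z; simp
  smul_left c x y := by ext z; simp
  add_right x y₁ y₂ := by ext z; simp
  smul_right c x y := by
    ext z
    have : inner ℂ (c • y) z = (c : ℂ) * inner ℂ y z := by
      rw [show c • y = (c : ℂ) • y from rfl, inner_smul_left, Complex.conj_ofReal]
    simp [this, mul_assoc]
  bound := ⟨1, one_pos, fun x y => by simp⟩

lemma pd_projector {k : Plane} (hv : DifferentiableAt ℝ v k) (j : Fin 2) (x : CVec n) :
    pd j (projector v) k x =
      inner ℂ (v k) x • pd j v k + inner ℂ (pd j v k) x • v k := by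
  have h := ((isBoundedBilinearMap_rankOne.hasFDerivAt (v k, v k)).comp k
    (hv.hasFDerivAt.prodMk hv.hasFDerivAt)).fderiv
  have h2 : pd j (projector v) k = _ := congrArg (fun L : Plane →L[ℝ] CVec n →L[ℂ] CVec n =>
    L (EuclideanSpace.single j 1)) h
  rw [h2]
  simp [pd, add_comm]

namespace IsAssignment

lemma contDiff (hv : IsAssignment b H E v) : ContDiff ℝ ⊤ v :=
  contDiff_omega_iff_analyticOnNhd.2 hv.analytic

lemma differentiableAt (hv : IsAssignment b H E v) (k : Plane) : DifferentiableAt ℝ v k :=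
  hv.contDiff.differentiable (by simp) k

lemma inner_self (hv : IsAssignment b H E v) (k : Plane) : inner ℂ (v k) (v k) = 1 := by
  rw [inner_self_eq_norm_sq_to_K, hv.norm_eq_one]
  simp

lemma contDiff_pd (hv : IsAssignment b H E v) (j : Fin 2) : ContDiff ℝ ⊤ (pd j v) :=
  _root_.contDiff_pd hv.contDiff (by simp) j

/-- The Berry connection of a normalized family is real. -/
lemma inner_pd (hv : IsAssignment b H E v) (j : Fin 2) (k : Plane) :
    inner ℂ (v k) (pd j v k) = -Complex.I * (berryConnection v k j : ℂ) := by
  have h := pd_inner (hv.differentiableAt k) (hv.differentiableAt k) j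
  simp only [hv.inner_self, pd_const] at h
  rw [← inner_conj_symm (pd j v k) (v k)] at h
  rw [berryConnection_apply]
  have hre := congrArg Complex.re h
  rw [Complex.add_re, Complex.conj_re, Complex.zero_re] at hre
  apply Complex.ext
  · simp; linarith
  · simp

lemma contDiff_berryConnection (hv : IsAssignment b H E v) (j : Fin 2) :
    ContDiff ℝ ⊤ fun k => berryConnection v k j := by
  simp only [berryConnection_apply]
  exact Complex.reCLM.contDiff.comp (contDiff_const.mul (hv.contDiff.inner ℂ (hv.contDiff_pd j)))

lemma periodic_berryConnection (hv : IsAssignment b H E v) :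
    IsLatticePeriodic b (berryConnection v) := fun k G hG => by
  ext j
  rw [berryConnection_apply, berryConnection_apply, hv.periodic k G hG,
    hv.periodic.pd j k G hG]

/-- By the product rule (∂P)v = ∂v + ⟨∂v, v⟩v, and ⟨∂v, v⟩ is the conjugate of −iA. This is the
Pfaffian system, rearranged. -/
lemma pd_projector_apply_self (hv : IsAssignment b H E v) (j : Fin 2) (k : Plane) :
    pd j (projector v) k (v k) =
      pd j v k + (Complex.I * (berryConnection v k j : ℂ)) • v k := by
  rw [pd_projector (hv.differentiableAt k), hv.inner_self, one_smul,
    ← inner_conj_symm (pd j v k) (v k), hv.inner_pd]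
  simp

lemma solvesPfaffian (hv : IsAssignment b H E v) : SolvesPfaffian v (berryConnection v) := by
  intro k j
  rw [hv.pd_projector_apply_self, add_sub_cancel_right]

/-- Pythagoras: (∂_jP)v is orthogonal to v, while the rest of ∂_jv is −iA_jv. -/
lemma norm_pd_sq (hv : IsAssignment b H E v) (j : Fin 2) (k : Plane) :
    ‖pd j v k‖ ^ 2 = ‖pd j (projector v) k (v k)‖ ^ 2 + berryConnection v k j ^ 2 := by
  have h0 : inner ℂ (pd j (projector v) k (v k)) (v k) = 0 := by
    rw [← inner_conj_symm, hv.pd_projector_apply_self, inner_add_right, inner_smul_right,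
      hv.inner_self, hv.inner_pd]
    simp
  rw [hv.solvesPfaffian k j, @norm_sub_sq ℂ, inner_smul_right, h0, norm_smul, hv.norm_eq_one]
  simp

/-- Two assignments for a nondegenerate band differ by a phase. -/
lemma eq_inner_smul (hH : IsNondegenerateBand b H E) (hv : IsAssignment b H E v)
    (hw : IsAssignment b H E w) (k : Plane) : v k = inner ℂ (w k) (v k) • w k := by
  let W := Module.End.eigenspace (Matrix.toEuclideanLin (H k)) (E k : ℂ)
  have hwm : w k ∈ W := Module.End.mem_eigenspace_iff.2 (hw.eigen k)
  have hvm : v k ∈ W := Module.End.mem_eigenspace_iff.2 (hv.eigen k)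
  have hne : (⟨w k, hwm⟩ : W) ≠ 0 := by
    intro h
    have h1 : w k = 0 := congrArg Subtype.val h
    have := hw.norm_eq_one k
    rw [h1, norm_zero] at this
    exact zero_ne_one this
  obtain ⟨c, hc⟩ := (finrank_eq_one_iff_of_nonzero' _ hne).1 (hH.nondegenerate k) ⟨v k, hvm⟩
  have hc' : c • w k = v k := congrArg Subtype.val hc
  rw [← hc', inner_smul_right, hw.inner_self, mul_one]

lemma norm_inner_eq_one (hH : IsNondegenerateBand b H E) (hv : IsAssignment b H E v)
    (hw : IsAssignment b H E w) (k : Plane) : ‖inner ℂ (w k) (v k)‖ = 1 := by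
  have h := congrArg norm (hv.eq_inner_smul hH hw k)
  rw [norm_smul, hv.norm_eq_one, hw.norm_eq_one, mul_one] at h
  exact h.symm

lemma contDiff_inner (hv : IsAssignment b H E v) (hw : IsAssignment b H E w) :
    ContDiff ℝ ⊤ fun k => inner ℂ (w k) (v k) := hw.contDiff.inner ℂ hv.contDiff

/-- The projector does not depend on the assignment. -/
lemma projector_eq (hH : IsNondegenerateBand b H E) (hv : IsAssignment b H E v)
    (hw : IsAssignment b H E w) : projector v = projector w := by
  ext1 k
  have h1 := hv.norm_inner_eq_one hH hw k
  have h2 := hv.eq_inner_smul hH hw k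
  generalize inner ℂ (w k) (v k) = c at h1 h2
  ext1 x
  simp only [projector, InnerProductSpace.rankOne_apply, h2, inner_smul_left, smul_smul]
  congr 1
  rw [mul_right_comm, Complex.conj_mul', h1]
  simp

/-- Gauge invariance of the first part of the variance: P is unchanged and the phase has modulus
one. -/
lemma norm_pd_projector_eq (hH : IsNondegenerateBand b H E) (hv : IsAssignment b H E v)
    (hw : IsAssignment b H E w) (j : Fin 2) (k : Plane) :
    ‖pd j (projector v) k (v k)‖ = ‖pd j (projector w) k (w k)‖ := by
  rw [hv.projector_eq hH hw, hv.eq_inner_smul hH hw k, map_smul, norm_smul,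
    hv.norm_inner_eq_one hH hw, one_mul]

/-- The phase between two assignments integrates the difference of their connections. -/
lemma pd_inner_eq (hH : IsNondegenerateBand b H E) (hv : IsAssignment b H E v)
    (hw : IsAssignment b H E w) (j : Fin 2) (k : Plane) :
    pd j (fun q => inner ℂ (w q) (v q)) k =
      -Complex.I * ((berryConnection v k j - berryConnection w k j : ℝ) : ℂ) *
        inner ℂ (w k) (v k) := by
  set c := fun q => inner ℂ (w q) (v q) with hc
  have hvc : v = fun q => c q • w q := funext (hv.eq_inner_smul hH hw)
  have hcd : DifferentiableAt ℝ c k := (hv.contDiff_inner hw).differentiable (by simp) k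
  have hcn : starRingEnd ℂ (c k) * c k = 1 := by
    rw [Complex.conj_mul', hv.norm_inner_eq_one hH hw]
    simp
  have h1 := hv.inner_pd j k
  have h2 : pd j v k = c k • pd j w k + pd j c k • w k := by
    conv_lhs => rw [hvc]
    exact pd_smul hcd (hw.differentiableAt k) j
  have h3 : v k = c k • w k := hv.eq_inner_smul hH hw k
  -- Pairing the derivative of v = cw with v gives −iA^v = |c|²(−iA^w) + c̄∂c; multiply by c and use
  -- |c| = 1.
  rw [h2, inner_add_right, h3, inner_smul_left, inner_smul_left, inner_smul_right,
    inner_smul_right, hw.inner_pd, hw.inner_self] at h1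
  change pd j c k = _ * c k
  push_cast
  linear_combination c k * h1 - (pd j c k - Complex.I * (berryConnection w k j : ℂ) * c k) * hcn

/-- The difference of two Berry connections of a band is curl-free. -/
lemma curl_sub_eq_zero (hH : IsNondegenerateBand b H E) (hv : IsAssignment b H E v)
    (hw : IsAssignment b H E w) (k : Plane) :
    pd 0 (fun q => berryConnection v q 1 - berryConnection w q 1) k =
      pd 1 (fun q => berryConnection v q 0 - berryConnection w q 0) k := by
  set c := fun q => inner ℂ (w q) (v q) with hc
  set B : Fin 2 → Plane → ℝ := fun j q => berryConnection v q j - berryConnection w q j with hB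
  have hBc : ∀ j, ContDiff ℝ ⊤ (B j) := fun j =>
    (hv.contDiff_berryConnection j).sub (hw.contDiff_berryConnection j)
  have hBd : ∀ j, DifferentiableAt ℝ (fun q => (B j q : ℂ)) k := fun j =>
    (Complex.ofRealCLM.contDiff.comp (hBc j)).differentiable (by simp) k
  have hcc := hv.contDiff_inner hw
  have hcd : DifferentiableAt ℝ c k := hcc.differentiable (by simp) k
  have h1 : ∀ j, pd j c = fun q => -Complex.I * (B j q : ℂ) * c q := fun j =>
    funext fun q => hv.pd_inner_eq hH hw j q
  have hofReal : ∀ i j, pd i (fun q => (B j q : ℂ)) k = ((pd i (B j) k : ℝ) : ℂ) := fun i j =>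
    congrArg (fun L : Plane →L[ℝ] ℂ => L (EuclideanSpace.single i 1))
      (Complex.ofRealCLM.hasFDerivAt.comp k
        ((hBc j).differentiable (by simp) k).hasFDerivAt).fderiv
  -- The term quadratic in B is symmetric in i and j, so equality of mixed derivatives leaves ∂_xB_y
  -- = ∂_yB_x once c ≠ 0 is cancelled.
  have h2 : ∀ i j, pd i (pd j c) k = -Complex.I * ((pd i (B j) k : ℝ) : ℂ) * c k +
      -Complex.I * (B j k : ℂ) * (-Complex.I * (B i k : ℂ) * c k) := by
    intro i j
    rw [h1 j, pd_mul ((differentiableAt_const _).fun_mul (hBd j)) hcd,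
      pd_mul (differentiableAt_const _) (hBd j), pd_const, hofReal, h1 i]
    ring
  have h3 := pd_pd_comm (hcc.of_le le_top) k 0 1
  change pd 0 (pd 1 c) k = pd 1 (pd 0 c) k at h3
  rw [h2, h2] at h3
  have hcne : c k ≠ 0 := by
    rw [← norm_ne_zero_iff, hv.norm_inner_eq_one hH hw]
    exact one_ne_zero
  have h4 : (Complex.I * c k) * (((pd 0 (B 1) k : ℝ) : ℂ) - ((pd 1 (B 0) k : ℝ) : ℂ)) = 0 := by
    linear_combination -h3
  have h5 := (mul_eq_zero.1 h4).resolve_left (mul_ne_zero Complex.I_ne_zero hcne)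
  exact_mod_cast sub_eq_zero.1 h5

end IsAssignment

lemma norm_exp_neg_I_mul (x : ℝ) : ‖Complex.exp (-Complex.I * (x : ℂ))‖ = 1 := by
  have : -Complex.I * (x : ℂ) = ((-x : ℝ) : ℂ) * Complex.I := by push_cast; ring
  rw [this, Complex.norm_exp_ofReal_mul_I]

lemma IsAssignment.gaugeTransform {ψ : Plane → ℝ} (hu : IsAssignment b H E u)
    (hψ : ContDiff ℝ ⊤ ψ) (hp : IsLatticePeriodic b ψ) :
    IsAssignment b H E (gaugeTransform ψ u) where
  analytic := contDiff_omega_iff_analyticOnNhd.1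
    (((contDiff_const.mul (Complex.ofRealCLM.contDiff.comp hψ)).cexp).smul hu.contDiff)
  periodic := hp.comp₂ hu.periodic fun x y => Complex.exp (-Complex.I * (x : ℂ)) • y
  norm_eq_one k := by
    rw [_root_.gaugeTransform, norm_smul, norm_exp_neg_I_mul, hu.norm_eq_one, one_mul]
  eigen k := by
    rw [_root_.gaugeTransform, map_smul, hu.eigen, smul_comm]

/-- The derivative of e^{-iψ} contributes −i∂_jψ to v*∂_jv, and the factor i turns it into +∂_jψ. -/
lemma IsAssignment.berryConnection_gaugeTransform {ψ : Plane → ℝ} (hu : IsAssignment b H E u)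
    (hψ : Differentiable ℝ ψ) (k : Plane) :
    berryConnection (_root_.gaugeTransform ψ u) k = berryConnection u k + gradient2 ψ k := by
  have hg : ∀ j, gradient2 ψ k j = pd j ψ k := fun j => by fin_cases j <;> rfl
  ext j
  rw [PiLp.add_apply, hg, berryConnection_apply]
  set e := fun q => Complex.exp (-Complex.I * (ψ q : ℂ)) with he
  have hd : HasFDerivAt e _ k :=
    (((Complex.ofRealCLM.hasFDerivAt.comp k (hψ k).hasFDerivAt).const_mul (-Complex.I)).cexp)
  have h1 : pd j e k = e k * (-Complex.I * ((pd j ψ k : ℝ) : ℂ)) := by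
    have : pd j e k = _ := congrArg (fun L : Plane →L[ℝ] ℂ =>
      L (EuclideanSpace.single j 1)) hd.fderiv
    rw [this]
    rfl
  have h2 : pd j (_root_.gaugeTransform ψ u) k = e k • pd j u k + pd j e k • u k :=
    pd_smul hd.differentiableAt (hu.differentiableAt k) j
  have h3 : _root_.gaugeTransform ψ u k = e k • u k := rfl
  have hen : starRingEnd ℂ (e k) * e k = 1 := by
    rw [Complex.conj_mul', norm_exp_neg_I_mul]
    simp
  have h4 : Complex.I * inner ℂ (_root_.gaugeTransform ψ u k)
      (pd j (_root_.gaugeTransform ψ u) k) = ((berryConnection u k j + pd j ψ k : ℝ) : ℂ) := by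
    rw [h2, h3, inner_add_right, inner_smul_left, inner_smul_left, inner_smul_right,
      inner_smul_right, hu.inner_pd, hu.inner_self, h1]
    push_cast
    linear_combination (-Complex.I ^ 2 * ((berryConnection u k j : ℂ) + ((pd j ψ k : ℝ) : ℂ))) * hen -
      ((berryConnection u k j : ℂ) + ((pd j ψ k : ℝ) : ℂ)) * Complex.I_sq
  rw [h4, Complex.ofReal_re]

end Berry

/-! ### Moments as means over the cell -/

section Moments

variable {n : ℕ} {a b : Fin 2 → Plane} {H : Plane → Matrix (Fin n) (Fin n) ℂ} {E : Plane → ℝ}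
  {u v w : Plane → CVec n}

lemma pd_component (hv : Differentiable ℝ v) (i : Fin n) (j : Fin 2) :
    (pd j fun k => v k i) = fun k => pd j v k i := by
  ext k
  have := (((EuclideanSpace.proj i : CVec n →L[ℂ] ℂ).restrictScalars ℝ).hasFDerivAt.comp k
    (hv k).hasFDerivAt).fderiv
  exact congrArg (fun L : Plane →L[ℝ] ℂ => L (EuclideanSpace.single j 1)) this

lemma contDiff_component {m : WithTop ℕ∞} (hv : ContDiff ℝ m v) (i : Fin n) :
    ContDiff ℝ m fun k => v k i :=
  ((EuclideanSpace.proj i : CVec n →L[ℂ] ℂ).restrictScalars ℝ).contDiff.comp hv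

namespace IsAssignment

lemma scalarCoeff_pd (hab : IsReciprocalPair a b) (hv : IsAssignment b H E v) (i : Fin n)
    (j : Fin 2) (m : Fin 2 → ℤ) :
    scalarCoeff a b (fun k => pd j v k i) m =
      Complex.I * (latticeVec a m j : ℂ) * scalarCoeff a b (fun k => v k i) m := by
  rw [← hab.scalarCoeff_pd (hv.periodic.comp fun x => x i)
    (contDiff_component (hv.contDiff.of_le le_top) i),
    pd_component (hv.contDiff.differentiable (by simp))]

/-- Parseval for v_i against ∂_jv_i, whose coefficients are iR_jv_{i,R}, combined with the pointwise
identity v*∂_jv = −iA_j. The minus sign cancels the one in the definition of the center. -/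
lemma hasSum_weight_mul_coord (hab : IsReciprocalPair a b) (hv : IsAssignment b H E v)
    (j : Fin 2) :
    HasSum (fun m => wannierWeight a b v (latticeVec a m) * latticeVec a m j)
      (-cellMean a b fun k => berryConnection v k j) := by
  have hcv : ∀ i, Continuous fun k => v k i := fun i =>
    (contDiff_component hv.contDiff i).continuous
  have hcp : ∀ i, Continuous fun k => pd j v k i := fun i =>
    (contDiff_component (hv.contDiff_pd j) i).continuous
  have h1 := hasSum_sum (s := Finset.univ) fun i _ => hab.hasSum_conj_scalarCoeff_mul
    (hv.periodic.comp fun x => x i) (hcv i) ((hv.periodic.pd j).comp fun x => x i) (hcp i)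
  have h2 : ∑ i, cellMean a b (fun k => starRingEnd ℂ (v k i) * pd j v k i) =
      -Complex.I * ((cellMean a b fun k => berryConnection v k j : ℝ) : ℂ) := by
    rw [← hab.cellMean_sum (f := fun i k => starRingEnd ℂ (v k i) * pd j v k i)
      fun i => (continuous_star.comp (hcv i)).mul (hcp i)]
    have h3 : (fun k => ∑ i, starRingEnd ℂ (v k i) * pd j v k i) =
        fun k => -Complex.I * (berryConnection v k j : ℂ) := by
      ext k
      rw [← hv.inner_pd, PiLp.inner_apply]
      simp [mul_comm]
    rw [h3, hab.cellMean_const_mul]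
    congr 1
    exact hab.cellMean_clm Complex.ofRealCLM (hv.contDiff_berryConnection j).continuous
  rw [h2] at h1
  have h4 := h1.mul_left (-Complex.I)
  have hval : -Complex.I * (-Complex.I *
      ((cellMean a b fun k => berryConnection v k j : ℝ) : ℂ)) =
      ((-cellMean a b fun k => berryConnection v k j : ℝ) : ℂ) := by
    rw [Complex.ofReal_neg]
    linear_combination ((cellMean a b fun k => berryConnection v k j : ℝ) : ℂ) * Complex.I_sq
  rw [hval] at h4
  refine Complex.hasSum_ofReal.1 (h4.congr_fun fun m => ?_)
  have h5 : (wannierWeight a b v (latticeVec a m) : ℂ) =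
      ∑ i, starRingEnd ℂ (scalarCoeff a b (fun k => v k i) m) *
        scalarCoeff a b (fun k => v k i) m := by
    simp only [wannierWeight, Complex.conj_mul', Complex.ofReal_sum, Complex.ofReal_pow]
    rfl
  rw [Complex.ofReal_mul, h5, Finset.sum_mul, Finset.mul_sum]
  refine Finset.sum_congr rfl fun i _ => ?_
  rw [hv.scalarCoeff_pd hab]
  linear_combination (starRingEnd ℂ (scalarCoeff a b (fun k => v k i) m) *
    scalarCoeff a b (fun k => v k i) m * (latticeVec a m j : ℂ)) * Complex.I_sq

/-- Parseval for ∂_jv_i against itself. -/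
lemma hasSum_weight_mul_coord_sq (hab : IsReciprocalPair a b) (hv : IsAssignment b H E v)
    (j : Fin 2) :
    HasSum (fun m => wannierWeight a b v (latticeVec a m) * latticeVec a m j ^ 2)
      (cellMean a b fun k => ‖pd j v k‖ ^ 2) := by
  have hcp : ∀ i, Continuous fun k => pd j v k i := fun i =>
    (contDiff_component (hv.contDiff_pd j) i).continuous
  have h1 := hasSum_sum (s := Finset.univ) fun i _ => hab.hasSum_conj_scalarCoeff_mul
    ((hv.periodic.pd j).comp fun x => x i) (hcp i) ((hv.periodic.pd j).comp fun x => x i) (hcp i)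
  have h2 : ∑ i, cellMean a b (fun k => starRingEnd ℂ (pd j v k i) * pd j v k i) =
      ((cellMean a b fun k => ‖pd j v k‖ ^ 2 : ℝ) : ℂ) := by
    rw [← hab.cellMean_sum (f := fun i k => starRingEnd ℂ (pd j v k i) * pd j v k i)
      fun i => (continuous_star.comp (hcp i)).mul (hcp i)]
    have h3 : (fun k => ∑ i, starRingEnd ℂ (pd j v k i) * pd j v k i) =
        fun k => ((‖pd j v k‖ ^ 2 : ℝ) : ℂ) := by
      ext k
      rw [EuclideanSpace.norm_sq_eq, Complex.ofReal_sum]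
      simp only [Complex.conj_mul', Complex.ofReal_pow]
    rw [h3]
    exact hab.cellMean_clm Complex.ofRealCLM ((hv.contDiff_pd j).continuous.norm.pow 2)
  rw [h2] at h1
  refine Complex.hasSum_ofReal.1 (h1.congr_fun fun m => ?_)
  simp only [hv.scalarCoeff_pd hab, Complex.conj_mul']
  rw [wannierWeight, Finset.sum_mul, Complex.ofReal_sum]
  refine Finset.sum_congr rfl fun i _ => ?_
  rw [norm_mul, norm_mul, Complex.norm_I, one_mul, Complex.norm_real, Real.norm_eq_abs]
  have h3 : ((|latticeVec a m j| : ℝ) : ℂ) ^ 2 = (latticeVec a m j : ℂ) ^ 2 := by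
    rw [← Complex.ofReal_pow, sq_abs, Complex.ofReal_pow]
  push_cast
  rw [mul_pow, h3, mul_comm]
  rfl

lemma hasSum_weight_mul_norm_sq (hab : IsReciprocalPair a b) (hv : IsAssignment b H E v) :
    HasSum (fun R : lattice a => wannierWeight a b v R * ‖(R : Plane)‖ ^ 2)
      (cellMean a b (fun k => ‖pd 0 v k‖ ^ 2) + cellMean a b fun k => ‖pd 1 v k‖ ^ 2) := by
  rw [← (latticeEquiv hab.cellDet_left).hasSum_iff]
  convert (hv.hasSum_weight_mul_coord_sq hab 0).add (hv.hasSum_weight_mul_coord_sq hab 1) using 1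
  ext m
  rw [Function.comp, latticeEquiv_coe, norm_sq_plane]
  ring

lemma summable_weight (hab : IsReciprocalPair a b) (hv : IsAssignment b H E v) :
    Summable fun R : lattice a => wannierWeight a b v R := by
  rw [← (latticeEquiv hab.cellDet_left).summable_iff]
  have hcv : ∀ i, Continuous fun k => v k i := fun i =>
    (contDiff_component hv.contDiff i).continuous
  have h : ∀ i ∈ Finset.univ, Summable fun m => ‖scalarCoeff a b (fun k => v k i) m‖ ^ 2 := by
    intro i _
    have := (hab.hasSum_conj_scalarCoeff_mul (hv.periodic.comp fun x => x i) (hcv i)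
      (hv.periodic.comp fun x => x i) (hcv i)).summable.norm
    refine this.congr fun m => ?_
    rw [norm_mul, RCLike.norm_conj, ← sq]
  exact summable_sum h

lemma wannierWeight_nonneg (R : Plane) : 0 ≤ wannierWeight a b v R :=
  Finset.sum_nonneg fun _ _ => by positivity

/-- The first moment is dominated through ‖R‖ ≤ 1 + ‖R‖². -/
lemma hasMoments (hab : IsReciprocalPair a b) (hv : IsAssignment b H E v) : HasMoments a b v := by
  refine ⟨?_, (hv.hasSum_weight_mul_norm_sq hab).summable⟩
  refine Summable.of_nonneg_of_le
    (fun R => mul_nonneg (wannierWeight_nonneg _) (norm_nonneg _)) (fun R => ?_)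
    ((hv.summable_weight hab).add (hv.hasSum_weight_mul_norm_sq hab).summable)
  have h0 : 0 ≤ wannierWeight a b v R := wannierWeight_nonneg _
  nlinarith [mul_nonneg h0 (sq_nonneg (‖(R : Plane)‖ - 1)),
    mul_nonneg h0 (sq_nonneg ‖(R : Plane)‖)]

lemma wannierSecondMoment_eq (hab : IsReciprocalPair a b) (hv : IsAssignment b H E v) :
    wannierSecondMoment a b v =
      cellMean a b (fun k => ‖pd 0 v k‖ ^ 2) + cellMean a b fun k => ‖pd 1 v k‖ ^ 2 :=
  (hv.hasSum_weight_mul_norm_sq hab).tsum_eq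

/-- The Wannier center is the mean of the Berry connection. -/
lemma wannierCenter_apply (hab : IsReciprocalPair a b) (hv : IsAssignment b H E v) (j : Fin 2) :
    wannierCenter a b v j = cellMean a b fun k => berryConnection v k j := by
  have hs : Summable fun R : lattice a => wannierWeight a b v R • (-(R : Plane)) := by
    refine Summable.of_norm ((hv.hasMoments hab).1.congr fun R => ?_)
    rw [norm_smul, norm_neg, Real.norm_of_nonneg (wannierWeight_nonneg _)]
  have h1 := hs.hasSum.mapL (EuclideanSpace.proj j : Plane →L[ℝ] ℝ)
  have h2 : HasSum (fun R : lattice a => wannierWeight a b v R * (R : Plane) j)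
      (-cellMean a b fun k => berryConnection v k j) := by
    rw [← (latticeEquiv hab.cellDet_left).hasSum_iff]
    exact hv.hasSum_weight_mul_coord hab j
  have h3 := h2.neg
  rw [neg_neg] at h3
  refine h1.unique (h3.congr_fun fun R => ?_)
  simp

end IsAssignment

end Moments

/-! ### Splitting of the variance -/

section Variance

variable {n : ℕ} {a b : Fin 2 → Plane} {H : Plane → Matrix (Fin n) (Fin n) ℂ} {E : Plane → ℝ}
  {u v w : Plane → CVec n} {ψ F : Plane → ℝ} {h : Plane}

lemma rotGradient_zero (F : Plane → ℝ) (k : Plane) : rotGradient F k 0 = pd 1 F k := rfl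

lemma rotGradient_one (F : Plane → ℝ) (k : Plane) : rotGradient F k 1 = -pd 0 F k := rfl

lemma contDiff_rotGradient (hF : ContDiff ℝ 2 F) (j : Fin 2) :
    ContDiff ℝ 1 fun k => rotGradient F k j := by
  fin_cases j
  · exact contDiff_pd hF (by norm_num) 1
  · exact (contDiff_pd hF (by norm_num) 0).neg

lemma curl_gradient_sub_const {B₀ B₁ : Plane → ℝ} (hψ : ContDiff ℝ 2 ψ) {c₀ c₁ : ℝ}
    (h₀ : B₀ = fun k => -pd 0 ψ k + c₀) (h₁ : B₁ = fun k => -pd 1 ψ k + c₁) (k : Plane) :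
    pd 0 B₁ k = pd 1 B₀ k := by
  have hd := fun j => (contDiff_pd hψ (m := 1) (by norm_num) j).differentiable one_ne_zero k
  rw [h₀, h₁, pd_add (hd 1).fun_neg (differentiableAt_const _),
    pd_add (hd 0).fun_neg (differentiableAt_const _), pd_neg, pd_neg, pd_const, pd_const,
    pd_pd_comm hψ]

lemma divergence_eq_zero_of_eq_rotGradient_add {A : Plane → Plane} (hF : ContDiff ℝ 2 F)
    (hA : ∀ k j, A k j = rotGradient F k j + h j) (k : Plane) : divergence A k = 0 := by
  have hd := fun j => (contDiff_pd hF (m := 1) (by norm_num) j).differentiable one_ne_zero k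
  have h0 : (fun q => A q 0) = fun q => pd 1 F q + h 0 := funext fun q => hA q 0
  have h1 : (fun q => A q 1) = fun q => -pd 0 F q + h 1 := funext fun q => hA q 1
  rw [divergence, h0, h1, pd_add (hd 1) (differentiableAt_const _),
    pd_add (hd 0).fun_neg (differentiableAt_const _), pd_neg, pd_const, pd_const, pd_pd_comm hF]
  ring

lemma IsLatticePeriodic.rotGradient (hF : IsLatticePeriodic b F) (j : Fin 2) :
    IsLatticePeriodic b fun k => rotGradient F k j := by
  fin_cases j
  · exact hF.pd 1
  · exact (hF.pd 0).comp Neg.neg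

lemma IsReciprocalPair.cellMean_rotGradient (hab : IsReciprocalPair a b)
    (hF : IsLatticePeriodic b F) (hc : ContDiff ℝ 1 F) (j : Fin 2) :
    cellMean a b (fun k => rotGradient F k j) = 0 := by
  fin_cases j
  · exact hab.cellMean_pd hF hc 1
  · have := hab.cellMean_const_mul (-1 : ℝ) (pd 0 F)
    rw [hab.cellMean_pd hF hc 0, mul_zero] at this
    rw [← this]
    congr 1
    ext k
    simp [rotGradient_one]

lemma IsReciprocalPair.cellMean_sub_mean_sq (hab : IsReciprocalPair a b) {f : Plane → ℝ}
    (hf : Continuous f) :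
    cellMean a b (fun k => (f k - cellMean a b f) ^ 2) =
      cellMean a b (fun k => f k ^ 2) - cellMean a b f ^ 2 := by
  set M := cellMean a b f with hM
  have : (fun k => (f k - M) ^ 2) = fun k => (f k ^ 2 - 2 * M * f k) + M ^ 2 := by
    ext k; ring
  rw [this, hab.cellMean_add (by fun_prop) (by fun_prop),
    hab.cellMean_sub (by fun_prop) (by fun_prop), hab.cellMean_const_mul, hab.cellMean_const, ← hM]
  ring

/-- The variance of an assignment splits into a gauge-invariant part and the variance of the
curl-free part of its Berry connection. -/
theorem IsAssignment.wannierVariance_eq (hab : IsReciprocalPair a b)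
    (hH : IsNondegenerateBand b H E) (hu : IsAssignment b H E u) (hv : IsAssignment b H E v)
    (hd : IsHodgeDecomposition b (berryConnection u) ψ F h) {B : Fin 2 → Plane → ℝ}
    (hB : ∀ j k, B j k = berryConnection v k j - rotGradient F k j) :
    wannierVariance a b v =
      cellMean a b (fun k => ‖pd 0 (projector u) k (u k)‖ ^ 2 +
        ‖pd 1 (projector u) k (u k)‖ ^ 2 + pd 0 F k ^ 2 + pd 1 F k ^ 2) +
      cellMean a b (fun k => (B 0 k - cellMean a b (B 0)) ^ 2 +
        (B 1 k - cellMean a b (B 1)) ^ 2) := by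
  have hAc := fun j => (hv.contDiff_berryConnection j).continuous
  have hFc1 := fun j => _root_.contDiff_pd hd.contDiff_F (m := 1) (by norm_num) j
  have hBeq : ∀ j, B j = fun k => berryConnection v k j - rotGradient F k j := fun j =>
    funext (hB j)
  have hBc1 : ∀ j, ContDiff ℝ 1 (B j) := fun j => by
    rw [hBeq]
    exact ((hv.contDiff_berryConnection j).of_le le_top).sub (contDiff_rotGradient hd.contDiff_F j)
  have hBp : ∀ j, IsLatticePeriodic b (B j) := fun j => by
    rw [hBeq]
    exact (hv.periodic_berryConnection.comp fun x => x j).comp₂ (hd.periodic_F.rotGradient j)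
      (· - ·)
  -- B is the sum of A^v − A^u, curl-free for one band, and of A^u minus the rotated gradient, which
  -- is −∇ψ + h.
  have hcurl : ∀ k, pd 0 (B 1) k = pd 1 (B 0) k := by
    intro k
    have hG := hv.curl_sub_eq_zero hH hu k
    have hgr := fun j => (_root_.contDiff_pd hd.contDiff_ψ (m := 1) (by norm_num) j)
    have hgd := fun j => (hgr j).differentiable one_ne_zero k
    have hAd : ∀ j, DifferentiableAt ℝ
        (fun q => berryConnection v q j - berryConnection u q j) k := fun j =>
      ((hv.contDiff_berryConnection j).sub (hu.contDiff_berryConnection j)).differentiable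
        (by simp) k
    have e0 : B 0 = fun q => (berryConnection v q 0 - berryConnection u q 0) +
        (-pd 0 ψ q + h 0) := by
      rw [hBeq]; ext q
      simp [hd.decomposition q, gradient2, rotGradient]
      ring
    have e1 : B 1 = fun q => (berryConnection v q 1 - berryConnection u q 1) +
        (-pd 1 ψ q + h 1) := by
      rw [hBeq]; ext q
      simp [hd.decomposition q, gradient2, rotGradient]
      ring
    rw [e0, e1, pd_add (hAd 1) ((hgd 1).fun_neg.fun_add (differentiableAt_const _)),
      pd_add (hAd 0) ((hgd 0).fun_neg.fun_add (differentiableAt_const _)), hG,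
      curl_gradient_sub_const hd.contDiff_ψ rfl rfl]
  have hrot := hab.cellMean_rot_mul_eq_zero hd.periodic_F (hBp 0) (hBp 1)
    (hd.contDiff_F.of_le (by norm_num)) (hBc1 0) (hBc1 1) hcurl
  -- Rotated gradients have mean zero, so B carries the whole center.
  have hmean : ∀ j, cellMean a b (fun k => berryConnection v k j) = cellMean a b (B j) := by
    intro j
    rw [hBeq, hab.cellMean_sub (hAc j) (contDiff_rotGradient hd.contDiff_F j).continuous,
      hab.cellMean_rotGradient hd.periodic_F (hd.contDiff_F.of_le (by norm_num)), sub_zero]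
  have hQc : ∀ j, Continuous fun k => ‖pd j (projector u) k (u k)‖ ^ 2 := fun j => by
    simp only [hu.pd_projector_apply_self]
    have h1 := (hu.contDiff_berryConnection j).continuous
    exact ((hu.contDiff_pd j).continuous.add ((continuous_const.mul
      (Complex.continuous_ofReal.comp h1)).smul hu.contDiff.continuous)).norm.pow 2
  have hbc := fun j => (hBc1 j).continuous
  have hfc := fun j => (hFc1 j).continuous
  have := hQc 0
  have := hQc 1
  have := hbc 0
  have := hbc 1
  have := hfc 0
  have := hfc 1
  have := hAc 0
  have := hAc 1
  have hsq : ∀ j, cellMean a b (fun k => ‖pd j v k‖ ^ 2) =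
      cellMean a b (fun k => ‖pd j (projector u) k (u k)‖ ^ 2) +
        cellMean a b fun k => berryConnection v k j ^ 2 := by
    intro j
    simp only [hv.norm_pd_sq, hv.norm_pd_projector_eq hH hu]
    exact hab.cellMean_add (hQc j) ((hAc j).pow 2)
  have hA0 : (fun k => berryConnection v k 0 ^ 2) =
      fun k => B 0 k ^ 2 + 2 * (B 0 k * pd 1 F k) + pd 1 F k ^ 2 := by
    ext k; rw [hB, rotGradient_zero]; ring
  have hA1 : (fun k => berryConnection v k 1 ^ 2) =
      fun k => B 1 k ^ 2 - 2 * (B 1 k * pd 0 F k) + pd 0 F k ^ 2 := by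
    ext k; rw [hB, rotGradient_one]; ring
  -- Orthogonality makes the two cross terms cancel.
  have hcross : cellMean a b (fun k => B 0 k * pd 1 F k) =
      cellMean a b fun k => B 1 k * pd 0 F k := by
    rw [hab.cellMean_sub (by fun_prop) (by fun_prop)] at hrot
    exact sub_eq_zero.1 hrot
  rw [wannierVariance, hv.wannierSecondMoment_eq hab, norm_sq_plane, hv.wannierCenter_apply hab,
    hv.wannierCenter_apply hab, hmean, hmean, hsq, hsq, hA0, hA1,
    hab.cellMean_add (by fun_prop) (by fun_prop), hab.cellMean_add (by fun_prop) (by fun_prop),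
    hab.cellMean_add (by fun_prop) (by fun_prop), hab.cellMean_sub (by fun_prop) (by fun_prop),
    hab.cellMean_add (by fun_prop) (by fun_prop), hab.cellMean_add (by fun_prop) (by fun_prop),
    hab.cellMean_add (by fun_prop) (by fun_prop), hab.cellMean_add (by fun_prop) (by fun_prop),
    hab.cellMean_sub_mean_sq (hbc 0), hab.cellMean_sub_mean_sq (hbc 1), hab.cellMean_const_mul,
    hab.cellMean_const_mul, hcross]
  ring

end Variance

/-! ### Optimality and uniqueness -/

section Optimal

variable {n : ℕ} {a b : Fin 2 → Plane} {H : Plane → Matrix (Fin n) (Fin n) ℂ} {E : Plane → ℝ}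
  {u v w : Plane → CVec n} {ψ F : Plane → ℝ} {h : Plane}

lemma gradient2_apply (f : Plane → ℝ) (k : Plane) (j : Fin 2) : gradient2 f k j = pd j f k := by
  fin_cases j <;> rfl

namespace IsAssignment

lemma exists_hodge (hab : IsReciprocalPair a b) (hu : IsAssignment b H E u) :
    ∃ (ψ F : Plane → ℝ) (h : Plane), ContDiff ℝ ⊤ ψ ∧ ContDiff ℝ ⊤ F ∧
      IsHodgeDecomposition b (berryConnection u) ψ F h :=
  hab.exists_hodge hu.periodic_berryConnection hu.contDiff_berryConnection

/-- Every classical periodic solution of the Poisson equation is analytic. -/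
lemma contDiff_of_poisson (hab : IsReciprocalPair a b) (hu : IsAssignment b H E u)
    (hψ : IsPeriodicPoissonSolution b (divergence (berryConnection u)) ψ) : ContDiff ℝ ⊤ ψ := by
  obtain ⟨ψ₁, F, h, hc, -, hd⟩ := hu.exists_hodge hab
  have hd1 := hψ.contDiff.differentiable two_ne_zero
  have hd2 := hc.differentiable (by simp)
  -- ψ has the same gradient as an analytic solution, so the two differ by a constant.
  have h1 := eq_of_pd_eq_zero (f := fun k => ψ k - ψ₁ k) (hd1.sub hd2) (fun j k => by
    rw [pd_sub (hd1 k) (hd2 k), hab.pd_eq_of_poisson hψ hd.poisson, sub_self])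
  have h2 : ψ = fun k => ψ₁ k + (ψ 0 - ψ₁ 0) := funext fun k => by
    rw [← h1 k 0, add_sub_cancel]
  rw [h2]
  exact hc.add contDiff_const

/-- The gauge adds ∇ψ and the decomposition contains −∇ψ₀. They cancel because two periodic
solutions of the same Poisson equation have equal gradients. -/
lemma berryConnection_gaugeTransform_eq (hab : IsReciprocalPair a b) (hu : IsAssignment b H E u)
    (hψ : IsPeriodicPoissonSolution b (divergence (berryConnection u)) ψ) {ψ₀ : Plane → ℝ}
    (hd : IsHodgeDecomposition b (berryConnection u) ψ₀ F h) (k : Plane) :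
    berryConnection (_root_.gaugeTransform ψ u) k = rotGradient F k + h := by
  rw [hu.berryConnection_gaugeTransform (hψ.contDiff.differentiable two_ne_zero),
    hd.decomposition]
  ext j
  simp only [PiLp.add_apply, PiLp.neg_apply, gradient2_apply,
    hab.pd_eq_of_poisson hψ hd.poisson j k]
  ring

lemma wannierVariance_gaugeTransform (hab : IsReciprocalPair a b)
    (hH : IsNondegenerateBand b H E) (hu : IsAssignment b H E u)
    (hψ : IsPeriodicPoissonSolution b (divergence (berryConnection u)) ψ) {ψ₀ : Plane → ℝ}
    (hd : IsHodgeDecomposition b (berryConnection u) ψ₀ F h) :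
    wannierVariance a b (_root_.gaugeTransform ψ u) =
      cellMean a b fun k => ‖pd 0 (projector u) k (u k)‖ ^ 2 +
        ‖pd 1 (projector u) k (u k)‖ ^ 2 + pd 0 F k ^ 2 + pd 1 F k ^ 2 := by
  rw [wannierVariance_eq hab hH hu
    (hu.gaugeTransform (hu.contDiff_of_poisson hab hψ) hψ.periodic) hd
    -- Here B is the constant h, so its variance term drops out.
    (B := fun j _ => h j) (fun j k => by
      rw [berryConnection_gaugeTransform_eq hab hu hψ hd]; simp)]
  simp [hab.cellMean_const]

lemma wannierCenter_gaugeTransform (hab : IsReciprocalPair a b) (hu : IsAssignment b H E u)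
    (hψ : IsPeriodicPoissonSolution b (divergence (berryConnection u)) ψ) {ψ₀ : Plane → ℝ}
    (hd : IsHodgeDecomposition b (berryConnection u) ψ₀ F h) :
    wannierCenter a b (_root_.gaugeTransform ψ u) = h := by
  ext j
  rw [(hu.gaugeTransform (hu.contDiff_of_poisson hab hψ) hψ.periodic).wannierCenter_apply hab]
  simp only [berryConnection_gaugeTransform_eq hab hu hψ hd, PiLp.add_apply]
  rw [hab.cellMean_add (contDiff_rotGradient hd.contDiff_F j).continuous continuous_const,
    hab.cellMean_rotGradient hd.periodic_F (hd.contDiff_F.of_le (by norm_num)),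
    hab.cellMean_const, zero_add]

theorem isOptimalAssignment_gaugeTransform (hab : IsReciprocalPair a b)
    (hH : IsNondegenerateBand b H E) (hu : IsAssignment b H E u)
    (hψ : IsPeriodicPoissonSolution b (divergence (berryConnection u)) ψ) :
    IsOptimalAssignment a b H E (_root_.gaugeTransform ψ u) := by
  obtain ⟨ψ₀, F, h, -, -, hd⟩ := hu.exists_hodge hab
  refine ⟨hu.gaugeTransform (hu.contDiff_of_poisson hab hψ) hψ.periodic, fun v hv => ?_⟩
  rw [wannierVariance_gaugeTransform hab hH hu hψ hd,
    wannierVariance_eq hab hH hu hv hd (B := fun j k => berryConnection v k j - rotGradient F k j)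
      fun _ _ => rfl]
  exact le_add_of_nonneg_right (hab.cellMean_nonneg fun k => by positivity)

end IsAssignment

/-- Comparison with the gauge-transformed u bounds the variance of B by zero. By continuity B equals
its mean everywhere, so A^v is a rotated gradient plus a constant. -/
theorem IsOptimalAssignment.divergence_eq_zero (hab : IsReciprocalPair a b)
    (hH : IsNondegenerateBand b H E) (hu : IsAssignment b H E u)
    (hv : IsOptimalAssignment a b H E v) (k : Plane) : divergence (berryConnection v) k = 0 := by
  obtain ⟨ψ, F, h, hψ, -, hd⟩ := hu.exists_hodge hab
  have hle := hv.2 _ (hu.gaugeTransform hψ hd.periodic_ψ)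
  set B : Fin 2 → Plane → ℝ := fun j k => berryConnection v k j - rotGradient F k j with hB
  rw [IsAssignment.wannierVariance_gaugeTransform hab hH hu hd.poisson hd,
    IsAssignment.wannierVariance_eq hab hH hu hv.1 hd (B := B) fun _ _ => rfl] at hle
  have hBp : ∀ j, IsLatticePeriodic b (B j) := fun j =>
    (hv.1.periodic_berryConnection.comp fun x => x j).comp₂ (hd.periodic_F.rotGradient j) (· - ·)
  have hBc : ∀ j, Continuous (B j) := fun j =>
    (hv.1.contDiff_berryConnection j).continuous.sub
      (contDiff_rotGradient hd.contDiff_F j).continuous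
  have := hBc 0
  have := hBc 1
  have h0 := hab.cellMean_nonneg (f := fun k => (B 0 k - cellMean a b (B 0)) ^ 2 +
    (B 1 k - cellMean a b (B 1)) ^ 2) fun k => by positivity
  have key := hab.eq_zero_of_cellMean_eq_zero (f := fun k => (B 0 k - cellMean a b (B 0)) ^ 2 +
    (B 1 k - cellMean a b (B 1)) ^ 2)
    ((hBp 0).comp₂ (hBp 1) fun x y => (x - cellMean a b (B 0)) ^ 2 + (y - cellMean a b (B 1)) ^ 2)
    (by fun_prop) (fun k => by positivity) (le_antisymm (by linarith) h0)
  refine divergence_eq_zero_of_eq_rotGradient_add (h := !₂[cellMean a b (B 0), cellMean a b (B 1)])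
    hd.contDiff_F (fun q => Fin.forall_fin_two.2 ⟨?_, ?_⟩) k
  · have h1 : B 0 q - cellMean a b (B 0) = 0 := by
      nlinarith [key q, sq_nonneg (B 0 q - cellMean a b (B 0)),
        sq_nonneg (B 1 q - cellMean a b (B 1))]
    change _ = _ + cellMean a b (B 0)
    rw [← sub_eq_zero.1 h1]
    simp [hB]
  · have h1 : B 1 q - cellMean a b (B 1) = 0 := by
      nlinarith [key q, sq_nonneg (B 0 q - cellMean a b (B 0)),
        sq_nonneg (B 1 q - cellMean a b (B 1))]
    change _ = _ + cellMean a b (B 1)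
    rw [← sub_eq_zero.1 h1]
    simp [hB]

/-- A vector `d` with `exp (i d · G) = 1` for the generators `G` of the reciprocal lattice is a
lattice vector. -/
lemma IsReciprocalPair.mem_lattice_of_exp_eq_one (hab : IsReciprocalPair a b) {d : Plane}
    (hd : ∀ i, Complex.exp (Complex.I * (inner ℝ d (b i) : ℂ)) = 1) : d ∈ lattice a := by
  obtain ⟨r, rfl⟩ := cellMap_surjective hab.cellDet_left d
  -- Pairing with b_i reads off 2π times the i-th coordinate of d, so the exponential condition
  -- makes that coordinate an integer.
  have hin : ∀ i, inner ℝ (cellMap a r) (b i) = 2 * Real.pi * r i := by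
    intro i
    simp only [cellMap_apply, inner_add_left, inner_smul_left, hab.inner_eq]
    fin_cases i <;> simp [mul_comm]
  have hint : ∀ i, ∃ m : ℤ, r i = m := by
    intro i
    obtain ⟨m, hm⟩ := Complex.exp_eq_one_iff.1 (hd i)
    refine ⟨m, ?_⟩
    rw [hin] at hm
    push_cast at hm
    have h1 : (2 * Real.pi * Complex.I : ℂ) * r i = (2 * Real.pi * Complex.I : ℂ) * m := by
      linear_combination hm
    exact_mod_cast mul_left_cancel₀ Complex.two_pi_I_ne_zero h1
  choose m hm using hint
  exact mem_lattice_iff.2 ⟨m, by rw [latticeVec, ← funext hm]⟩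

/-- Divergence-free Berry connections of a band differ by a lattice vector. -/
theorem IsAssignment.exists_berryConnection_sub_eq (hab : IsReciprocalPair a b)
    (hH : IsNondegenerateBand b H E) (hv : IsAssignment b H E v) (hw : IsAssignment b H E w)
    (hdv : ∀ k, divergence (berryConnection v) k = 0)
    (hdw : ∀ k, divergence (berryConnection w) k = 0) :
    ∃ d ∈ lattice a, ∀ k, berryConnection v k - berryConnection w k = d := by
  have hd : ∀ {f : Plane → ℝ}, ContDiff ℝ ⊤ f → ∀ k, DifferentiableAt ℝ f k := fun hf k =>
    hf.differentiable (by simp) k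
  have hvc := hv.contDiff_berryConnection
  have hwc := hw.contDiff_berryConnection
  have hp : ∀ j, IsLatticePeriodic b fun k => berryConnection v k j - berryConnection w k j :=
    fun j => hv.periodic_berryConnection.comp₂ hw.periodic_berryConnection fun x y => x j - y j
  have hconst := hab.eq_of_divergence_curl_eq_zero (hp 0) (hp 1)
    (((hvc 0).sub (hwc 0)).of_le le_top) (((hvc 1).sub (hwc 1)).of_le le_top)
    (fun k => by
      rw [pd_sub (hd (hvc 0) k) (hd (hwc 0) k), pd_sub (hd (hvc 1) k) (hd (hwc 1) k)]
      have h1 := hdv k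
      have h2 := hdw k
      unfold divergence at h1 h2
      linarith) (hv.curl_sub_eq_zero hH hw)
  set d := berryConnection v 0 - berryConnection w 0 with hd_def
  have hsub : ∀ k, berryConnection v k - berryConnection w k = d := fun k => by
    ext j
    rw [hd_def, PiLp.sub_apply, PiLp.sub_apply]
    revert j
    exact Fin.forall_fin_two.2 (hconst k 0)
  refine ⟨d, ?_, hsub⟩
  set c := fun q => inner ℂ (w q) (v q) with hc
  set e := fun q : Plane => Complex.exp (Complex.I * (inner ℝ d q : ℂ)) with he
  let ℓ : Plane →L[ℝ] ℂ := Complex.I • Complex.ofRealCLM ∘L innerSL ℝ d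
  have hed : ∀ k, HasFDerivAt e (e k • ℓ) k := fun k => ℓ.hasFDerivAt.cexp
  have hcd : Differentiable ℝ c := (hv.contDiff_inner hw).differentiable (by simp)
  have hpde : ∀ j k, pd j e k = e k * (Complex.I * (d j : ℂ)) := by
    intro j k
    have : pd j e k = _ := congrArg (fun L : Plane →L[ℝ] ℂ =>
      L (EuclideanSpace.single j 1)) (hed k).fderiv
    have h2 : ℓ (EuclideanSpace.single j 1) = Complex.I * (d j : ℂ) := by
      change Complex.I * ((inner ℝ d (EuclideanSpace.single j 1) : ℝ) : ℂ) = _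
      rw [EuclideanSpace.inner_single_right, one_mul, conj_trivial]
    rw [this, ← h2]
    rfl
  -- The logarithmic derivatives of e^{i d·k} and of the phase c are id and −id, so their product is
  -- constant.
  have hprod := eq_of_pd_eq_zero (f := fun k => e k * c k)
    (fun k => (hed k).differentiableAt.mul (hcd k)) (fun j k => by
      have h1 : berryConnection v k j - berryConnection w k j = d j := by
        rw [← hsub k, PiLp.sub_apply]
      rw [pd_mul (hed k).differentiableAt (hcd k), hpde, hv.pd_inner_eq hH hw, h1]
      ring)
  refine hab.mem_lattice_of_exp_eq_one fun i => ?_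
  have hbi : b i ∈ lattice b := by
    refine mem_lattice_iff.2 ⟨Pi.single i 1, ?_⟩
    rw [latticeVec_apply]
    fin_cases i <;> simp
  have h1 := hprod (b i) 0
  have h2 : c (b i) = c 0 := by
    have := hw.periodic.comp₂ hv.periodic (inner ℂ) 0 (b i) hbi
    rwa [zero_add] at this
  have h3 : e 0 = 1 := by simp [he]
  have h4 : c 0 ≠ 0 := by
    rw [← norm_ne_zero_iff, hv.norm_inner_eq_one hH hw]
    exact one_ne_zero
  -- Compare the values at b_i and 0: c is periodic and nonzero, hence e^{i d·b_i} = 1.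
  simp only [h2, h3] at h1
  exact mul_right_cancel₀ h4 h1

end Optimal
end

/-! ### The main theorem -/

theorem mainTheorem5 {n : ℕ} (a b : Fin 2 → Plane) (hab : IsReciprocalPair a b)
    (H : Plane → Matrix (Fin n) (Fin n) ℂ) (E : Plane → ℝ) (hH : IsNondegenerateBand b H E)
    (u : Plane → CVec n) (hu : IsAssignment b H E u) :
    -- moments and Berry connection of every assignment are meaningful
    (∀ v, IsAssignment b H E v → HasMoments a b v ∧ SolvesPfaffian v (berryConnection v)) ∧
    -- the Hodge decomposition and the solution of Poisson's equation exist
    (∃ (ψ F : Plane → ℝ) (h : Plane),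
      AnalyticOnNhd ℝ ψ Set.univ ∧ AnalyticOnNhd ℝ F Set.univ ∧
      IsHodgeDecomposition b (berryConnection u) ψ F h ∧
      IsPeriodicPoissonSolution b (divergence (berryConnection u)) ψ) ∧
    -- optimality of the gauge transform, its Berry connection, center and variance
    (∀ ψ : Plane → ℝ, IsPeriodicPoissonSolution b (divergence (berryConnection u)) ψ →
      IsOptimalAssignment a b H E (gaugeTransform ψ u) ∧
      (∀ k, divergence (berryConnection (gaugeTransform ψ u)) k = 0) ∧
      ∀ (ψ₀ F : Plane → ℝ) (h : Plane), IsHodgeDecomposition b (berryConnection u) ψ₀ F h →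
        (∀ k, berryConnection (gaugeTransform ψ u) k = rotGradient F k + h) ∧
        wannierCenter a b (gaugeTransform ψ u) = h ∧
        wannierVariance a b (gaugeTransform ψ u) = cellMean a b fun k =>
          ‖pd 0 (projector u) k (gaugeTransform ψ u k)‖ ^ 2 +
            ‖pd 1 (projector u) k (gaugeTransform ψ u k)‖ ^ 2 +
            (pd 0 F k) ^ 2 + (pd 1 F k) ^ 2) ∧
    -- optimal connections are divergence-free, and unique up to a lattice vector
    (∀ v, IsOptimalAssignment a b H E v → ∀ k, divergence (berryConnection v) k = 0) ∧
    (∀ v₁ v₂, IsAssignment b H E v₁ → IsAssignment b H E v₂ →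
      (∀ k, divergence (berryConnection v₁) k = 0) →
      (∀ k, divergence (berryConnection v₂) k = 0) →
      ∃ d ∈ lattice a, ∀ k, berryConnection v₁ k - berryConnection v₂ k = d) := by
  refine ⟨fun v hv => ⟨hv.hasMoments hab, hv.solvesPfaffian⟩, ?_, fun ψ hψ => ⟨?_, ?_, ?_⟩, ?_, ?_⟩
  · obtain ⟨ψ, F, h, hψ, hF, hd⟩ := hu.exists_hodge hab
    exact ⟨ψ, F, h, contDiff_omega_iff_analyticOnNhd.1 hψ, contDiff_omega_iff_analyticOnNhd.1 hF,
      hd, hd.poisson⟩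
  · exact hu.isOptimalAssignment_gaugeTransform hab hH hψ
  · exact (hu.isOptimalAssignment_gaugeTransform hab hH hψ).divergence_eq_zero hab hH hu
  · intro ψ₀ F h hd
    have hw := hu.gaugeTransform (hu.contDiff_of_poisson hab hψ) hψ.periodic
    refine ⟨hu.berryConnection_gaugeTransform_eq hab hψ hd,
      hu.wannierCenter_gaugeTransform hab hψ hd, ?_⟩
    rw [hu.wannierVariance_gaugeTransform hab hH hψ hd]
    -- The variance formula was obtained with ∂P applied to u; replacing u by w = e^{-iψ}u leaves
    -- the norms unchanged.
    have hP : ∀ j k, ‖pd j (projector u) k (gaugeTransform ψ u k)‖ =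
        ‖pd j (projector u) k (u k)‖ := fun j k => by
      rw [← hw.norm_pd_projector_eq hH hu, hw.projector_eq hH hu]
    simp only [hP]
  · exact fun v hv => hv.divergence_eq_zero hab hH hu
  · exact fun v₁ v₂ h₁ h₂ hd₁ hd₂ => h₁.exists_berryConnection_sub_eq hab hH h₂ hd₁ hd₂
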